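/- Let $\mathrm{Lie}[a,b]$ be the free Lie algebra over $\mathbb{Q}$ on $a,b$. For $i\ge 0$ let $\varepsilon_{2i}$ be the derivation of $\mathrm{Lie}[a,b]$ with $$\varepsilon_{2i}(a)=\mathrm{ad}(a)^{2i}(b),\qquad \varepsilon_{2i}(b)=\sum_{j=0}^{i-1}(-1)^j\bigl[\mathrm{ad}(a)^{j}(b),\mathrm{ad}(a)^{2i-1-j}(b)\bigr],$$ and let $\mathcal{E}\subset\mathrm{Der}\,\mathrm{Lie}[a,b]$ be the Lie subalgebra generated by the $\varepsilon_{2i}$, $i\ge 0$ (Pollack's Lie algebra). A mould is a family $A=(A_r)_{r\ge0}$ with $A_r\in\mathbb{Q}(u_1,\dots,u_r)$, and $\mathrm{ARI}$ is the space of moulds with $A_0=0$, with the bracket $$\mathrm{ari}(A,B)=\mathrm{arit}(B)\cdot A-\mathrm{arit}(A)\cdot B+\mathrm{mu}(A,B)-\mathrm{mu}(B,A),$$ where $\mathrm{mu}(A,B)(u_1,\dots,u_r)=\sum_{i=0}^rA(u_1,\dots,u_i)B(u_{i+1},\dots,u_r)$ and $$(\mathrm{arit}(B)\cdot A)(u_1,\dots,u_r)=\sum_{0\le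 k<l<r}A(u_1,\dots,u_k,u_{k+1}+\cdots+u_{l+1},u_{l+2},\dots,u_r)\,B(u_{k+1},\dots,u_l)-\sum_{1\le k<l\le r}A(u_1,\dots,u_{k-1},u_k+\cdots+u_l,u_{l+1},\dots,u_r)\,B(u_{k+1},\dots,u_l).$$ For $i\ge -1$ let $U_{2i}\in\mathrm{ARI}$ be the mould concentrated in depth $1$ with $U_{2i}(u_1)=u_1^{2i}$, and let $\mathcal{U}\subset\mathrm{ARI}$ be the Lie algebra generated by the $U_{2i}$, $i\ge -1$, under $\mathrm{ari}$, i.e. the smallest $\mathbb{Q}$-subspace containing them and closed under $\mathrm{ari}$. By Lazard elimination $\mathrm{Lie}[a,b]=\mathbb{Q}a\oplus\mathrm{Lie}[C_1,C_2,\dots]$, where $C_i=\mathrm{ad}(a)^{i-1}(b)$ and the second summand is the free Lie algebra on the $C_i$. Let $\mathrm{ma}:\mathrm{Lie}[C_1,C_2,\dots]\to\mathrm{ARI}$ be the linear map obtained by expanding in $\mathbb{Q}\langle C_1,C_2,\dots\rangle$ and sending $C_{i_1}\cdots C_{i_r}$ to $(-1)^{i_1+\cdots+i_r-r}u_1^{i_1-1}\cdots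 u_r^{i_r-1}$ in depth $r$. Let $\mathrm{Der}^0\mathrm{Lie}[a,b]$ be the space of derivations $D$ with $D([a,b])=0$ such that $D(a)$ has no linear term in $a$, and define $\Psi:\mathrm{Der}^0\mathrm{Lie}[a,b]\to\mathrm{ARI}$ by $$\Psi(D)(u_1,\dots,u_r)=\frac{\mathrm{ma}(D(a))(u_1,\dots,u_r)}{u_1\cdots u_r(u_1+\cdots+u_r)}\qquad(r\ge1).$$ Then for every $i\ge0$ we have $\varepsilon_{2i}\in\mathrm{Der}^0\mathrm{Lie}[a,b]$ and $\Psi(\varepsilon_{2i})=U_{2i-2}\in\mathcal{U}$. Moreover $\mathcal{E}\subset\mathrm{Der}^0\mathrm{Lie}[a,b]$, $\mathcal{U}$ is a Lie algebra under $\mathrm{ari}$, and $\Psi$ restricts to an isomorphism of Lie algebras $\mathcal{E}\simeq\mathcal{U}$. -/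

import Mathlib

noncomputable section

namespace EllipticMould

/-! ### Derivations of a free Lie algebra with prescribed values on the generators -/

/-- `L ⊕ tL` with `t² = 0`; the pair `(x, v)` stands for `x + t v`. -/
def Tangent (L : Type) : Type := L × L

def Tangent.mk {L : Type} (x v : L) : Tangent L := (x, v)

section Tangent

set_option linter.unusedSectionVars false

variable {L : Type} [LieRing L] [LieAlgebra ℚ L]

instance : AddCommGroup (Tangent L) := inferInstanceAs (AddCommGroup (L × L))

instance : Module ℚ (Tangent L) := inferInstanceAs (Module ℚ (L × L))

instance : Bracket (Tangent L) (Tangent L) where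
  bracket x y := Tangent.mk ⁅x.1, y.1⁆ (⁅x.1, y.2⁆ + ⁅x.2, y.1⁆)

theorem Tangent.fst_lie (x y : Tangent L) : (⁅x, y⁆ : Tangent L).1 = ⁅x.1, y.1⁆ := rfl

theorem Tangent.snd_lie (x y : Tangent L) :
    (⁅x, y⁆ : Tangent L).2 = ⁅x.1, y.2⁆ + ⁅x.2, y.1⁆ := rfl

theorem Tangent.fst_add (x y : Tangent L) : (x + y).1 = x.1 + y.1 := rfl

theorem Tangent.snd_add (x y : Tangent L) : (x + y).2 = x.2 + y.2 := rfl

theorem Tangent.fst_smul (c : ℚ) (x : Tangent L) : (c • x).1 = c • x.1 := rfl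

theorem Tangent.snd_smul (c : ℚ) (x : Tangent L) : (c • x).2 = c • x.2 := rfl

theorem Tangent.ext {x y : Tangent L} (h₁ : x.1 = y.1) (h₂ : x.2 = y.2) : x = y :=
  Prod.ext h₁ h₂

instance : LieRing (Tangent L) where
  add_lie x y z := by
    apply Tangent.ext
    · simp only [Tangent.fst_lie, Tangent.fst_add, add_lie]
    · simp only [Tangent.snd_lie, Tangent.fst_add, Tangent.snd_add, add_lie]; abel
  lie_add x y z := by
    apply Tangent.ext
    · simp only [Tangent.fst_lie, Tangent.fst_add, lie_add]
    · simp only [Tangent.snd_lie, Tangent.fst_add, Tangent.snd_add, lie_add]; abel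
  lie_self x := by
    apply Tangent.ext
    · exact lie_self x.1
    · change ⁅x.1, x.2⁆ + ⁅x.2, x.1⁆ = 0
      rw [← lie_skew x.1 x.2]; abel
  leibniz_lie x y z := by
    apply Tangent.ext
    · exact leibniz_lie x.1 y.1 z.1
    · simp only [Tangent.snd_lie, Tangent.fst_lie, Tangent.snd_add, lie_add, add_lie]
      rw [leibniz_lie x.1 y.1 z.2, leibniz_lie x.1 y.2 z.1, leibniz_lie x.2 y.1 z.1]
      abel

instance : LieAlgebra ℚ (Tangent L) where
  lie_smul t x y := by
    apply Tangent.ext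
    · simp only [Tangent.fst_lie, Tangent.fst_smul, lie_smul]
    · simp only [Tangent.snd_lie, Tangent.fst_smul, Tangent.snd_smul, lie_smul, smul_add]

end Tangent

section FreeDerivation

variable {X : Type}

/-- The Lie algebra morphism `P ↦ P + t D(P)` with `D(x) = f x` on the generators. -/
def tangentLift (f : X → FreeLieAlgebra ℚ X) :
    FreeLieAlgebra ℚ X →ₗ⁅ℚ⁆ Tangent (FreeLieAlgebra ℚ X) :=
  FreeLieAlgebra.lift ℚ fun x => Tangent.mk (FreeLieAlgebra.of ℚ x) (f x)

theorem tangentLift_fst (f : X → FreeLieAlgebra ℚ X) (P : FreeLieAlgebra ℚ X) :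
    (tangentLift f P).1 = P := by
  let p : Tangent (FreeLieAlgebra ℚ X) →ₗ⁅ℚ⁆ FreeLieAlgebra ℚ X :=
    { toFun := fun x => x.1
      map_add' := fun _ _ => rfl
      map_smul' := fun _ _ => rfl
      map_lie' := rfl }
  have h : p.comp (tangentLift f) = LieHom.id := by
    apply FreeLieAlgebra.hom_ext
    intro x
    rw [LieHom.comp_apply, tangentLift, FreeLieAlgebra.lift_of_apply]
    rfl
  exact LieHom.congr_fun h P

/-- The unique derivation of the free Lie algebra on `X` with `D(x) = f x` for `x ∈ X`. -/
def freeDerivation (f : X → FreeLieAlgebra ℚ X) :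
    LieDerivation ℚ (FreeLieAlgebra ℚ X) (FreeLieAlgebra ℚ X) where
  toFun P := (tangentLift f P).2
  map_add' P Q := by rw [map_add]; rfl
  map_smul' c P := by rw [map_smul]; rfl
  leibniz' P Q := by
    change (tangentLift f ⁅P, Q⁆).2 = ⁅P, (tangentLift f Q).2⁆ - ⁅Q, (tangentLift f P).2⁆
    rw [LieHom.map_lie, Tangent.snd_lie, tangentLift_fst, tangentLift_fst,
      ← lie_skew Q (tangentLift f P).2, sub_neg_eq_add]

theorem freeDerivation_of (f : X → FreeLieAlgebra ℚ X) (x : X) :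
    freeDerivation f (FreeLieAlgebra.of ℚ x) = f x := by
  change (tangentLift f (FreeLieAlgebra.of ℚ x)).2 = f x
  rw [tangentLift, FreeLieAlgebra.lift_of_apply]
  rfl

end FreeDerivation

/-! ### The free Lie algebra on `a, b` and Pollack's Lie algebra -/

inductive Letter : Type
  | a
  | b

/-- `Lie[a, b]` over `ℚ`. -/
abbrev LieAB : Type := FreeLieAlgebra ℚ Letter

def genA : LieAB := FreeLieAlgebra.of ℚ Letter.a

def genB : LieAB := FreeLieAlgebra.of ℚ Letter.b

/-- `Der Lie[a, b]`. -/
abbrev DerAB : Type := LieDerivation ℚ LieAB LieAB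

/-- `a ^ n · P = ad(a) ^ n (P)`. -/
def adA (n : ℕ) (P : LieAB) : LieAB := ((LieAlgebra.ad ℚ LieAB genA) ^ n) P

/-- The derivation `ε_{2i}`. -/
def eps (i : ℕ) : DerAB :=
  freeDerivation fun
    | Letter.a => adA (2 * i) genB
    | Letter.b => ∑ j ∈ Finset.range i, (-1 : ℚ) ^ j • ⁅adA j genB, adA (2 * i - 1 - j) genB⁆

/-- Pollack's Lie algebra: the Lie subalgebra of `Der Lie[a, b]` generated by the `ε_{2i}`,
`i ≥ 0`. -/
def pollack : LieSubalgebra ℚ DerAB := LieSubalgebra.lieSpan ℚ DerAB (Set.range eps)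

/-! ### Lazard elimination -/

/-- The free Lie algebra on `C₁, C₂, …`; the generator with index `n` is `C_{n+1}`. -/
abbrev LieC : Type := FreeLieAlgebra ℚ ℕ

/-- The derivation of `Lie[C₁, C₂, …]` with `C_i ↦ C_{i+1}`, that is, the action of `ad(a)`. -/
def shiftC : LieDerivation ℚ LieC LieC := freeDerivation fun n => FreeLieAlgebra.of ℚ (n + 1)

section Associative

attribute [local instance] LieRing.ofAssociativeRing

/-- The one-dimensional Lie algebra `ℚ a` acting on `Lie[C₁, C₂, …]`. -/
def shiftAction : ℚ →ₗ⁅ℚ⁆ LieDerivation ℚ LieC LieC where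
  toFun t := t • shiftC
  map_add' s t := add_smul s t shiftC
  map_smul' s t := mul_smul s t shiftC
  map_lie' := by
    intro s t
    have h : (⁅s, t⁆ : ℚ) = 0 := by rw [Ring.lie_def, mul_comm, sub_self]
    change (⁅s, t⁆ : ℚ) • shiftC = ⁅s • shiftC, t • shiftC⁆
    rw [h, zero_smul, smul_lie, lie_smul, lie_self, smul_zero, smul_zero]

/-- Lazard's isomorphism `Lie[a, b] = ℚ a ⊕ Lie[C₁, C₂, …]`, `C_i = ad(a)^{i-1}(b)`, where the
right-hand side is the semidirect sum in which `a` acts by `C_i ↦ C_{i+1}`. -/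
def lazard : LieAB →ₗ⁅ℚ⁆ LieAlgebra.SemiDirectSum LieC ℚ shiftAction :=
  FreeLieAlgebra.lift ℚ fun
    | Letter.a => ⟨0, 1⟩
    | Letter.b => ⟨FreeLieAlgebra.of ℚ 0, 0⟩

/-- The inclusion `Lie[C₁, C₂, …] → Lie[a, b]`, `C_i ↦ ad(a)^{i-1}(b)`. -/
def inclC : LieC →ₗ⁅ℚ⁆ LieAB := FreeLieAlgebra.lift ℚ fun n => adA n genB

theorem lazard_genA : lazard genA = ⟨0, 1⟩ := by
  rw [lazard, genA, FreeLieAlgebra.lift_of_apply]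

theorem lazard_adA (n : ℕ) : lazard (adA n genB) = ⟨FreeLieAlgebra.of ℚ n, 0⟩ := by
  induction n with
  | zero =>
    rw [adA, pow_zero, Module.End.one_apply, lazard, genB, FreeLieAlgebra.lift_of_apply]
  | succ n ih =>
    have h : adA (n + 1) genB = ⁅genA, adA n genB⁆ := by
      rw [adA, adA, pow_succ', Module.End.mul_apply, LieAlgebra.ad_apply]
    rw [h, LieHom.map_lie, ih, lazard_genA, LieAlgebra.SemiDirectSum.lie_eq_mk]
    have h1 : shiftAction 1 (FreeLieAlgebra.of ℚ n) = FreeLieAlgebra.of ℚ (n + 1) := by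
      change ((1 : ℚ) • shiftC) (FreeLieAlgebra.of ℚ n) = _
      rw [one_smul, shiftC, freeDerivation_of]
    simp [h1]

/-- `lazard` restricts to the identity on `Lie[C₁, C₂, …]`. -/
theorem lazard_inclC (Q : LieC) : lazard (inclC Q) = ⟨Q, 0⟩ := by
  have h : lazard.comp inclC = LieAlgebra.SemiDirectSum.inl shiftAction := by
    apply FreeLieAlgebra.hom_ext
    intro n
    rw [LieHom.comp_apply, inclC, FreeLieAlgebra.lift_of_apply, lazard_adA]
    rfl
  exact LieHom.congr_fun h Q

/-- The component of `P` in `Lie[C₁, C₂, …]`. -/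
def partC : LieAB →ₗ[ℚ] LieC :=
  (LieAlgebra.SemiDirectSum.projl shiftAction).comp lazard.toLinearMap

/-- The coefficient of the linear term in `a`. -/
def coeffA : LieAB →ₗ[ℚ] ℚ :=
  (LieAlgebra.SemiDirectSum.projr shiftAction).toLinearMap.comp lazard.toLinearMap

/-- `ℚ⟨C₁, C₂, …⟩`; the letter with index `n` is `C_{n+1}`. -/
abbrev PolyC : Type := MonoidAlgebra ℚ (FreeMonoid ℕ)

/-- The expansion of Lie polynomials, `Lie[C₁, C₂, …] → ℚ⟨C₁, C₂, …⟩`. -/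
def expandLieHom : LieC →ₗ⁅ℚ⁆ PolyC :=
  FreeLieAlgebra.lift ℚ fun n => MonoidAlgebra.single (FreeMonoid.of n) 1

/-- The linear map underlying `expandLieHom`. -/
def expandC : LieC →ₗ[ℚ] PolyC := expandLieHom.toLinearMap

end Associative

/-- The space of derivations killing `[a, b]` and whose value at `a` has no linear term
in `a`. -/
def derZero : Submodule ℚ DerAB where
  carrier := {D | D ⁅genA, genB⁆ = 0 ∧ coeffA (D genA) = 0}
  add_mem' := by
    rintro D E ⟨h₁, h₂⟩ ⟨h₃, h₄⟩
    refine ⟨?_, ?_⟩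
    · rw [LieDerivation.add_apply, h₁, h₃, add_zero]
    · rw [LieDerivation.add_apply, map_add, h₂, h₄, add_zero]
  zero_mem' := ⟨rfl, by rw [LieDerivation.zero_apply, map_zero]⟩
  smul_mem' := by
    rintro c D ⟨h₁, h₂⟩
    refine ⟨?_, ?_⟩
    · rw [LieDerivation.smul_apply, h₁, smul_zero]
    · rw [LieDerivation.smul_apply, map_smul, h₂, smul_zero]

/-! ### Moulds and the ari-bracket -/

/-- `ℚ(u₁, …, u_r)`. -/
def RatFun (r : ℕ) : Type := FractionRing (MvPolynomial (Fin r) ℚ)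

instance (r : ℕ) : Field (RatFun r) := inferInstanceAs (Field (FractionRing (MvPolynomial (Fin r) ℚ)))

instance (r : ℕ) : Algebra (MvPolynomial (Fin r) ℚ) (RatFun r) :=
  inferInstanceAs (Algebra (MvPolynomial (Fin r) ℚ) (FractionRing (MvPolynomial (Fin r) ℚ)))

instance (r : ℕ) : IsFractionRing (MvPolynomial (Fin r) ℚ) (RatFun r) :=
  inferInstanceAs
    (IsFractionRing (MvPolynomial (Fin r) ℚ) (FractionRing (MvPolynomial (Fin r) ℚ)))

instance (r : ℕ) : CharZero (RatFun r) :=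
  charZero_of_injective_algebraMap
    (IsFractionRing.injective (MvPolynomial (Fin r) ℚ) (RatFun r))

/-- The variable `u_{i+1}`. -/
def var {r : ℕ} (i : Fin r) : RatFun r :=
  algebraMap (MvPolynomial (Fin r) ℚ) (RatFun r) (MvPolynomial.X i)

/-- A (rational-function valued) mould `(A_r)_{r ≥ 0}`. -/
abbrev Mould : Type := ∀ r : ℕ, RatFun r

/-- The value of a rational function at a point with coordinates in a field; used below only at
points where the denominator does not vanish. -/
def evalRat {s : ℕ} {K : Type} [Field K] [Algebra ℚ K] (x : Fin s → K) (F : RatFun s) : K :=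
  MvPolynomial.aeval x (IsFractionRing.num (MvPolynomial (Fin s) ℚ) F) /
    MvPolynomial.aeval x (IsFractionRing.den (MvPolynomial (Fin s) ℚ) F : MvPolynomial (Fin s) ℚ)

/-- `A(w) = A_s(w₁, …, w_s)` for a word `w` of length `s`. -/
def atWord {K : Type} [Field K] [Algebra ℚ K] (A : Mould) (w : List K) : K :=
  evalRat w.get (A w.length)

/-- `a⌈c`: the sum of the letters of `b` is added to the first letter of `c`. -/
def flexLeft {K : Type} [Field K] (a b c : List K) : List K :=
  match c with
  | [] => a
  | x :: c' => a ++ (b.sum + x) :: c'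

/-- `a⌉c`: the sum of the letters of `b` is added to the last letter of `a`. -/
def flexRight {K : Type} [Field K] (a b c : List K) : List K :=
  match a.reverse with
  | [] => c
  | x :: a' => a'.reverse ++ (x + b.sum) :: c

/-- The word `(u₁, …, u_r)`. -/
def genericWord (r : ℕ) : List (RatFun r) := List.ofFn (var (r := r))

/-- `arit(B) · A`. In each term the word is cut as `a b c` with `a = (u₁, …, u_k)`,
`b = (u_{k+1}, …, u_l)`, `c = (u_{l+1}, …, u_r)`. -/
def arit (B A : Mould) : Mould := fun r =>
  (∑ k ∈ Finset.range r, ∑ l ∈ Finset.Ioo k r,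
    atWord A (flexLeft ((genericWord r).take k) (((genericWord r).take l).drop k)
      ((genericWord r).drop l)) * atWord B (((genericWord r).take l).drop k)) -
  ∑ k ∈ Finset.Icc 1 r, ∑ l ∈ Finset.Ioc k r,
    atWord A (flexRight ((genericWord r).take k) (((genericWord r).take l).drop k)
      ((genericWord r).drop l)) * atWord B (((genericWord r).take l).drop k)

/-- The product `mu(A, B)`. -/
def mu (A B : Mould) : Mould := fun r =>
  ∑ i ∈ Finset.range (r + 1),
    atWord A ((genericWord r).take i) * atWord B ((genericWord r).drop i)

def lu (A B : Mould) : Mould := mu A B - mu B A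

def ari (A B : Mould) : Mould := arit B A - arit A B + lu A B

/-- The space of moulds with `A(∅) = 0`. -/
def ARI : Submodule ℚ Mould where
  carrier := {A | A 0 = 0}
  add_mem' := by
    intro A B hA hB
    change A 0 + B 0 = 0
    rw [show A 0 = 0 from hA, show B 0 = 0 from hB, add_zero]
  zero_mem' := rfl
  smul_mem' := by
    intro c A hA
    change c • A 0 = 0
    rw [show A 0 = 0 from hA, smul_zero]

theorem ari_mem (A B : Mould) : ari A B ∈ ARI := by
  change ari A B 0 = 0
  have hg : genericWord 0 = [] := rfl
  simp only [ari, lu, Pi.add_apply, Pi.sub_apply, arit, mu, hg]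
  simp [mul_comm]

/-- The ari-bracket on `ARI`. -/
instance : Bracket ARI ARI where
  bracket A B := ⟨ari A B, ari_mem A B⟩

/-- The mould concentrated in depth `1` with value `u₁ ^ n`, `n ∈ ℤ`. -/
def mouldU (n : ℤ) : ARI where
  val := Pi.single 1 (var 0 ^ n)
  property := by
    change (Pi.single 1 (var 0 ^ n) : Mould) 0 = 0
    exact Pi.single_eq_of_ne (by decide) _

/-- `𝒰`: the smallest subspace of `ARI` which contains `U_{2i}` for all `i ≥ -1` and is closed
under the ari-bracket. -/
def algU : Submodule ℚ ARI :=
  sInf {V | (∀ i : ℤ, -1 ≤ i → mouldU (2 * i) ∈ V) ∧ ∀ A ∈ V, ∀ B ∈ V, ⁅A, B⁆ ∈ V}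

theorem algU_lie_mem {A B : ARI} (hA : A ∈ algU) (hB : B ∈ algU) : ⁅A, B⁆ ∈ algU := by
  rw [algU, Submodule.mem_sInf] at *
  intro V hV
  exact hV.2 A (hA V hV) B (hB V hV)

/-- The ari-bracket restricted to `𝒰`. -/
instance : Bracket algU algU where
  bracket A B := ⟨⁅(A : ARI), (B : ARI)⁆, algU_lie_mem A.2 B.2⟩

/-! ### The maps `ma`, `Δ⁻¹ ma` and `Ψ` -/

/-- `C_{i₁} ⋯ C_{i_r} ↦ (-1)^{i₁+⋯+i_r-r} u₁^{i₁-1} ⋯ u_r^{i_r-1}` in depth `r`; the letter with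
index `n` of the word `w` is `C_{n+1}`. -/
def maWord (w : List ℕ) : Mould :=
  Pi.single w.length ((-1) ^ w.sum * ∏ j : Fin w.length, var j ^ w.get j)

/-- `ma` on `ℚ⟨C₁, C₂, …⟩`. -/
def maPoly : PolyC →ₗ[ℚ] Mould :=
  (Finsupp.linearCombination ℚ fun w : FreeMonoid ℕ => maWord w.toList).comp
    (MonoidAlgebra.coeffLinearEquiv ℚ : PolyC ≃ₗ[ℚ] (FreeMonoid ℕ →₀ ℚ)).toLinearMap

/-- `ma` on `Lie[a, b]`, through the component in `Lie[C₁, C₂, …]`. -/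
def ma : LieAB →ₗ[ℚ] Mould := maPoly.comp (expandC.comp partC)

/-- `Δ_r = u₁ ⋯ u_r (u₁ + ⋯ + u_r)`. -/
def Delta (r : ℕ) : RatFun r := (∏ j : Fin r, var j) * ∑ j : Fin r, var j

/-- `Da(P)_r = ma(P)_r / Δ_r` for `r ≥ 1`. -/
def Da : LieAB →ₗ[ℚ] ARI where
  toFun P := ⟨fun r => if r = 0 then 0 else ma P r / Delta r, if_pos rfl⟩
  map_add' P Q := by
    apply Subtype.ext
    funext r
    change (if r = 0 then 0 else ma (P + Q) r / Delta r) =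
      (if r = 0 then 0 else ma P r / Delta r) + (if r = 0 then 0 else ma Q r / Delta r)
    split_ifs
    · rw [add_zero]
    · rw [map_add, Pi.add_apply, add_div]
  map_smul' c P := by
    apply Subtype.ext
    funext r
    change (if r = 0 then 0 else ma (c • P) r / Delta r) =
      c • (if r = 0 then 0 else ma P r / Delta r)
    split_ifs
    · rw [smul_zero]
    · rw [map_smul, Pi.smul_apply, div_eq_mul_inv, div_eq_mul_inv, smul_mul_assoc]

/-- `Ψ(D) = Da(D(a))` on derivations which kill `[a, b]` and whose value at `a` has no linear term
in `a`. -/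
def Psi : derZero →ₗ[ℚ] ARI where
  toFun D := Da ((D : DerAB) genA)
  map_add' D E := by
    rw [Submodule.coe_add, LieDerivation.add_apply, map_add]
  map_smul' c D := by
    rw [Submodule.coe_smul, LieDerivation.smul_apply, map_smul, RingHom.id_apply]

/-! ### Lie brackets on vector spaces -/

/-- The operation `⁅·, ·⁆` makes the `ℚ`-vector space `V` a Lie algebra. -/
structure IsLieAlgebra (V : Type) [AddCommGroup V] [Module ℚ V] [Bracket V V] : Prop where
  add_lie : ∀ x y z : V, ⁅x + y, z⁆ = ⁅x, z⁆ + ⁅y, z⁆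
  lie_add : ∀ x y z : V, ⁅x, y + z⁆ = ⁅x, y⁆ + ⁅x, z⁆
  smul_lie : ∀ (c : ℚ) (x y : V), ⁅c • x, y⁆ = c • ⁅x, y⁆
  lie_smul : ∀ (c : ℚ) (x y : V), ⁅x, c • y⁆ = c • ⁅x, y⁆
  lie_self : ∀ x : V, ⁅x, x⁆ = 0
  leibniz_lie : ∀ x y z : V, ⁅x, ⁅y, z⁆⁆ = ⁅⁅x, y⁆, z⁆ + ⁅y, ⁅x, z⁆⁆

end EllipticMould

end

noncomputable section

namespace EllipticMould

/-! ### Free Lie algebras -/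

section FreeLie

variable {X : Type}

theorem freeLie_induction {p : FreeLieAlgebra ℚ X → Prop}
    (of : ∀ x, p (FreeLieAlgebra.of ℚ x)) (zero : p 0)
    (add : ∀ P Q, p P → p Q → p (P + Q)) (smul : ∀ (c : ℚ) P, p P → p (c • P))
    (lie : ∀ P Q, p P → p Q → p ⁅P, Q⁆) (P : FreeLieAlgebra ℚ X) : p P := by
  let S : LieSubalgebra ℚ (FreeLieAlgebra ℚ X) :=
    { carrier := {P | p P}
      add_mem' := fun h₁ h₂ => add _ _ h₁ h₂
      zero_mem' := zero
      smul_mem' := fun c _ h => smul c _ h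
      lie_mem' := fun h₁ h₂ => lie _ _ h₁ h₂ }
  have h : S.incl.comp (FreeLieAlgebra.lift ℚ fun x => (⟨FreeLieAlgebra.of ℚ x, of x⟩ : S)) =
      LieHom.id := by
    apply FreeLieAlgebra.hom_ext
    intro x
    rw [LieHom.comp_apply, FreeLieAlgebra.lift_of_apply]
    rfl
  have h' := LieHom.congr_fun h P
  rw [LieHom.comp_apply, LieHom.id_apply] at h'
  rw [← h']
  exact (FreeLieAlgebra.lift ℚ fun x => (⟨FreeLieAlgebra.of ℚ x, of x⟩ : S)) P |>.2

/-- Derivations along a morphism which agree on the generators agree everywhere. -/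
theorem freeLie_derivation_ext {L : Type} [LieRing L] [LieAlgebra ℚ L]
    (φ : FreeLieAlgebra ℚ X →ₗ⁅ℚ⁆ L) (u v : FreeLieAlgebra ℚ X →ₗ[ℚ] L)
    (hu : ∀ P Q, u ⁅P, Q⁆ = ⁅φ P, u Q⁆ + ⁅u P, φ Q⁆)
    (hv : ∀ P Q, v ⁅P, Q⁆ = ⁅φ P, v Q⁆ + ⁅v P, φ Q⁆)
    (h : ∀ x, u (FreeLieAlgebra.of ℚ x) = v (FreeLieAlgebra.of ℚ x)) (P : FreeLieAlgebra ℚ X) :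
    u P = v P := by
  induction P using freeLie_induction with
  | of x => exact h x
  | zero => rw [map_zero, map_zero]
  | add P Q h₁ h₂ => rw [map_add, map_add, h₁, h₂]
  | smul c P h₁ => rw [map_smul, map_smul, h₁]
  | lie P Q h₁ h₂ => rw [hu, hv, h₁, h₂]

theorem lieDerivation_lie {L : Type} [LieRing L] [LieAlgebra ℚ L] (D : LieDerivation ℚ L L)
    (x y : L) : D ⁅x, y⁆ = ⁅x, D y⁆ + ⁅D x, y⁆ := by
  rw [LieDerivation.apply_lie_eq_sub, ← lie_skew y (D x), sub_neg_eq_add]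

/-- The derivation which multiplies a homogeneous Lie polynomial by its degree. -/
def eulerDer (X : Type) : LieDerivation ℚ (FreeLieAlgebra ℚ X) (FreeLieAlgebra ℚ X) :=
  freeDerivation (FreeLieAlgebra.of ℚ)

/-- The span of the homogeneous Lie polynomials of positive degree. -/
def posDegree (X : Type) : Submodule ℚ (FreeLieAlgebra ℚ X) :=
  Submodule.span ℚ {P | ∃ n : ℕ, eulerDer X P = ((n : ℚ) + 1) • P}

theorem mem_posDegree (P : FreeLieAlgebra ℚ X) : P ∈ posDegree X := by
  induction P using freeLie_induction with
  | of x =>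
    refine Submodule.subset_span ⟨0, ?_⟩
    rw [Nat.cast_zero, zero_add, one_smul]
    exact freeDerivation_of _ x
  | zero => exact zero_mem _
  | add P Q h₁ h₂ => exact add_mem h₁ h₂
  | smul c P h => exact Submodule.smul_mem _ c h
  | lie P Q h₁ h₂ =>
    have key : ∀ P ∈ {P | ∃ n : ℕ, eulerDer X P = ((n : ℚ) + 1) • P}, ⁅P, Q⁆ ∈ posDegree X := by
      rintro P ⟨m, hP⟩
      refine Submodule.span_induction (p := fun Q _ => ⁅P, Q⁆ ∈ posDegree X) ?_ ?_ ?_ ?_ h₂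
      · rintro Q ⟨n, hQ⟩
        refine Submodule.subset_span ⟨m + n + 1, ?_⟩
        rw [lieDerivation_lie, hP, hQ, lie_smul, smul_lie, ← add_smul]
        congr 1
        push_cast
        ring
      · rw [lie_zero]; exact zero_mem _
      · intro R S _ _ h h'
        rw [lie_add]
        exact add_mem h h'
      · intro c R _ h
        rw [lie_smul]
        exact Submodule.smul_mem _ c h
    refine Submodule.span_induction (p := fun P _ => ⁅P, Q⁆ ∈ posDegree X) key ?_ ?_ ?_ h₁
    · rw [zero_lie]; exact zero_mem _
    · intro R S _ _ h h'
      rw [add_lie]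
      exact add_mem h h'
    · intro c R _ h
      rw [smul_lie]
      exact Submodule.smul_mem _ c h

theorem eulerDer_injective {P : FreeLieAlgebra ℚ X} (h : eulerDer X P = 0) : P = 0 := by
  have hd := (Module.End.eigenspaces_iSupIndep (eulerDer X).toLinearMap) 0
  refine Submodule.disjoint_def.1 hd P ?_ ?_
  · rw [Module.End.mem_eigenspace_iff, zero_smul]
    exact h
  · refine (Submodule.span_le.2 ?_ : posDegree X ≤ _) (mem_posDegree P)
    rintro Q ⟨n, hQ⟩
    have hn : (n : ℚ) + 1 ≠ 0 := by positivity
    exact Submodule.mem_iSup_of_mem _ (Submodule.mem_iSup_of_mem hn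
      (Module.End.mem_eigenspace_iff.2 hQ))

end FreeLie

/-! ### The expansion of Lie polynomials -/

/-- The letter `C_{n+1}` of `ℚ⟨C₁, C₂, …⟩`. -/
def letterC (n : ℕ) : PolyC := MonoidAlgebra.single (FreeMonoid.of n) 1

section Associative

attribute [local instance] LieRing.ofAssociativeRing

theorem expandC_of (n : ℕ) : expandC (FreeLieAlgebra.of ℚ n) = letterC n :=
  FreeLieAlgebra.lift_of_apply _ _

theorem expandC_lie (P Q : LieC) :
    expandC ⁅P, Q⁆ = expandC P * expandC Q - expandC Q * expandC P := by
  change expandLieHom ⁅P, Q⁆ = _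
  rw [LieHom.map_lie, Ring.lie_def]
  rfl

/-- The endomorphism `(Q, t) ↦ ([P, Q] + t R, 0)` of `Lie[C₁, C₂, …] ⊕ ℚ`. -/
def affineAction (P R : LieC) : Module.End ℚ (LieC × ℚ) where
  toFun z := (⁅P, z.1⁆ + z.2 • R, 0)
  map_add' y z := by
    ext
    · simp only [Prod.fst_add, Prod.snd_add, lie_add, add_smul]; abel
    · simp
  map_smul' c z := by
    ext
    · simp [lie_smul, smul_add, mul_smul]
    · simp

/-- The representation of `ℚ⟨C₁, C₂, …⟩` with `C_i · (Q, t) = ([C_i, Q] + t C_i, 0)`. -/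
def affineRep : PolyC →ₐ[ℚ] Module.End ℚ (LieC × ℚ) :=
  MonoidAlgebra.lift ℚ _ _ (FreeMonoid.lift fun n =>
    affineAction (FreeLieAlgebra.of ℚ n) (FreeLieAlgebra.of ℚ n))

theorem affineRep_expandC (P : LieC) : affineRep (expandC P) = affineAction P (eulerDer ℕ P) := by
  induction P using freeLie_induction with
  | of n =>
    rw [expandC_of, letterC, affineRep, MonoidAlgebra.lift_single, one_smul, FreeMonoid.lift_eval_of,
      eulerDer, freeDerivation_of]
  | zero =>
    ext z <;> simp [affineAction]
  | add P Q h₁ h₂ =>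
    rw [map_add, map_add, h₁, h₂]
    ext z <;> simp [affineAction]
  | smul c P h =>
    rw [map_smul, map_smul, h]
    ext z <;> simp [affineAction]
  | lie P Q h₁ h₂ =>
    rw [expandC_lie, map_sub, map_mul, map_mul, h₁, h₂, lieDerivation_lie]
    refine LinearMap.ext fun z => Prod.ext ?_ ?_
    · simp only [affineAction, LinearMap.sub_apply, Module.End.mul_apply, LinearMap.coe_mk,
        AddHom.coe_mk, Prod.fst_sub, zero_smul, add_zero, lie_add, lie_smul, smul_add]
      rw [leibniz_lie P Q z.1, ← lie_skew Q (eulerDer ℕ P)]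
      simp only [smul_neg]
      abel
    · simp [affineAction]

/-- The free Lie algebra embeds into the free associative algebra. -/
theorem expandC_injective {P : LieC} (h : expandC P = 0) : P = 0 := by
  apply eulerDer_injective
  have h' := affineRep_expandC P
  rw [h, map_zero] at h'
  have h₂ := congrArg Prod.fst (LinearMap.congr_fun h' (0, 1))
  simpa [affineAction] using h₂.symm

/-! ### Derivations of the free associative algebra -/

theorem polyC_hom_ext {V : Type} [AddCommGroup V] [Module ℚ V] {u v : PolyC →ₗ[ℚ] V}
    (h : ∀ w : List ℕ, u (MonoidAlgebra.single (FreeMonoid.ofList w) 1) =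
      v (MonoidAlgebra.single (FreeMonoid.ofList w) 1)) : u = v := by
  refine LinearMap.ext fun f => ?_
  induction f using MonoidAlgebra.induction_linear with
  | zero => rw [map_zero, map_zero]
  | add f g hf hg => rw [map_add, map_add, hf, hg]
  | single m c =>
    have : (MonoidAlgebra.single m c : PolyC) = c • MonoidAlgebra.single m 1 := by
      rw [MonoidAlgebra.smul_single, smul_eq_mul, mul_one]
    rw [this, map_smul, map_smul]
    exact congrArg _ (h m.toList)

/-- The linear map on `ℚ⟨C₁, C₂, …⟩` with prescribed values on the words. -/
def polyLift {V : Type} [AddCommGroup V] [Module ℚ V] (φ : List ℕ → V) : PolyC →ₗ[ℚ] V :=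
  (Finsupp.linearCombination ℚ fun w : FreeMonoid ℕ => φ w.toList).comp
    (MonoidAlgebra.coeffLinearEquiv ℚ : PolyC ≃ₗ[ℚ] (FreeMonoid ℕ →₀ ℚ)).toLinearMap

theorem polyLift_single {V : Type} [AddCommGroup V] [Module ℚ V] (φ : List ℕ → V) (w : List ℕ)
    (c : ℚ) : polyLift φ (MonoidAlgebra.single (FreeMonoid.ofList w) c) = c • φ w := by
  change Finsupp.linearCombination ℚ (fun w : FreeMonoid ℕ => φ w.toList)
    (MonoidAlgebra.single (FreeMonoid.ofList w) c).coeff = _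
  rw [MonoidAlgebra.coeff_single, Finsupp.linearCombination_single]
  rfl

theorem single_nil : (MonoidAlgebra.single (FreeMonoid.ofList []) 1 : PolyC) = 1 := rfl

theorem single_cons (n : ℕ) (w : List ℕ) :
    (MonoidAlgebra.single (FreeMonoid.ofList (n :: w)) 1 : PolyC) =
      letterC n * MonoidAlgebra.single (FreeMonoid.ofList w) 1 := by
  rw [letterC, MonoidAlgebra.single_mul_single, one_mul]
  rfl

/-- The value on a word of the derivation with `C_{n+1} ↦ g n`. -/
def derWord (g : ℕ → PolyC) : List ℕ → PolyC
  | [] => 0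
  | n :: w => g n * MonoidAlgebra.single (FreeMonoid.ofList w) 1 + letterC n * derWord g w

/-- The derivation of `ℚ⟨C₁, C₂, …⟩` with `C_{n+1} ↦ g n`. -/
def polyDer (g : ℕ → PolyC) : PolyC →ₗ[ℚ] PolyC := polyLift (derWord g)

theorem polyDer_cons (g : ℕ → PolyC) (n : ℕ) (f : PolyC) :
    polyDer g (letterC n * f) = g n * f + letterC n * polyDer g f := by
  have h : (polyDer g).comp (LinearMap.mulLeft ℚ (letterC n)) =
      LinearMap.mulLeft ℚ (g n) + (LinearMap.mulLeft ℚ (letterC n)).comp (polyDer g) := by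
    apply polyC_hom_ext
    intro w
    simp only [LinearMap.comp_apply, LinearMap.mulLeft_apply, LinearMap.add_apply]
    rw [← single_cons, polyDer, polyLift_single, polyLift_single, one_smul, one_smul]
    rfl
  exact LinearMap.congr_fun h f

theorem polyDer_one (g : ℕ → PolyC) : polyDer g 1 = 0 := by
  rw [← single_nil, polyDer, polyLift_single, one_smul]
  rfl

theorem polyDer_letterC (g : ℕ → PolyC) (n : ℕ) : polyDer g (letterC n) = g n := by
  have h := polyDer_cons g n 1
  rwa [polyDer_one, mul_zero, add_zero, mul_one, mul_one] at h

theorem polyDer_mul (g : ℕ → PolyC) (f f' : PolyC) :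
    polyDer g (f * f') = polyDer g f * f' + f * polyDer g f' := by
  have h : (polyDer g).comp (LinearMap.mulRight ℚ f') =
      (LinearMap.mulRight ℚ f').comp (polyDer g) + LinearMap.mulRight ℚ (polyDer g f') := by
    apply polyC_hom_ext
    intro w
    simp only [LinearMap.comp_apply, LinearMap.mulRight_apply, LinearMap.add_apply]
    induction w with
    | nil => rw [single_nil, polyDer_one, zero_mul, zero_add, one_mul, one_mul]
    | cons n w ih =>
      rw [single_cons, mul_assoc, polyDer_cons, ih, polyDer_cons]
      noncomm_ring
  exact LinearMap.congr_fun h f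

theorem expandC_freeDerivation (d : ℕ → LieC) (X : LieC) :
    expandC (freeDerivation d X) = polyDer (fun n => expandC (d n)) (expandC X) := by
  induction X using freeLie_induction with
  | of n => rw [freeDerivation_of, expandC_of, polyDer_letterC]
  | zero => simp only [map_zero]
  | add P Q h₁ h₂ => simp only [map_add, h₁, h₂]
  | smul c P h => simp only [map_smul, h]
  | lie P Q h₁ h₂ =>
    rw [lieDerivation_lie, map_add, expandC_lie, expandC_lie, expandC_lie, h₁, h₂, map_sub,
      polyDer_mul, polyDer_mul]
    abel

/-! ### Derivations preserving `Lie[C₁, C₂, …]` -/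

theorem adA_zero (P : LieAB) : adA 0 P = P := rfl

theorem adA_succ (n : ℕ) (P : LieAB) : adA (n + 1) P = ⁅genA, adA n P⁆ := by
  rw [adA, adA, pow_succ', Module.End.mul_apply, LieAlgebra.ad_apply]

theorem inclC_of (n : ℕ) : inclC (FreeLieAlgebra.of ℚ n) = adA n genB :=
  FreeLieAlgebra.lift_of_apply _ _

theorem partC_inclC (X : LieC) : partC (inclC X) = X := by
  change (lazard (inclC X)).left = X
  rw [lazard_inclC]

theorem coeffA_inclC (X : LieC) : coeffA (inclC X) = 0 := by
  change (lazard (inclC X)).right = 0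
  rw [lazard_inclC]

theorem coeffA_genA : coeffA genA = 1 := by
  change (lazard genA).right = 1
  rw [lazard_genA]

theorem coeffA_lie (P Q : LieAB) : coeffA ⁅P, Q⁆ = 0 := by
  change (lazard ⁅P, Q⁆).right = 0
  rw [LieHom.map_lie, LieAlgebra.SemiDirectSum.lie_eq_mk]
  change (lazard P).right * (lazard Q).right - (lazard Q).right * (lazard P).right = 0
  ring

theorem genA_lie_inclC (X : LieC) : ⁅genA, inclC X⁆ = inclC (shiftC X) := by
  refine freeLie_derivation_ext inclC
    ((LieAlgebra.ad ℚ LieAB genA).comp (inclC : LieC →ₗ[ℚ] LieAB))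
    ((inclC : LieC →ₗ[ℚ] LieAB).comp shiftC.toLinearMap) ?_ ?_ ?_ X
  · intro P Q
    change ⁅genA, inclC ⁅P, Q⁆⁆ = ⁅inclC P, ⁅genA, inclC Q⁆⁆ + ⁅⁅genA, inclC P⁆, inclC Q⁆
    rw [LieHom.map_lie, leibniz_lie, add_comm]
  · intro P Q
    change inclC (shiftC ⁅P, Q⁆) = ⁅inclC P, inclC (shiftC Q)⁆ + ⁅inclC (shiftC P), inclC Q⁆
    rw [lieDerivation_lie, map_add, LieHom.map_lie, LieHom.map_lie]
  · intro n
    change ⁅genA, inclC (FreeLieAlgebra.of ℚ n)⁆ = inclC (shiftC (FreeLieAlgebra.of ℚ n))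
    rw [inclC_of, shiftC, freeDerivation_of, inclC_of, adA_succ]

theorem eq_smul_add_inclC (P : LieAB) : P = coeffA P • genA + inclC (partC P) := by
  have key : ∀ P : LieAB, ∃ (c : ℚ) (X : LieC), P = c • genA + inclC X := by
    intro P
    induction P using freeLie_induction with
    | of x =>
      cases x with
      | a => exact ⟨1, 0, by rw [one_smul, map_zero, add_zero]; rfl⟩
      | b => exact ⟨0, FreeLieAlgebra.of ℚ 0, by rw [zero_smul, zero_add, inclC_of]; rfl⟩
    | zero => exact ⟨0, 0, by rw [zero_smul, map_zero, add_zero]⟩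
    | add P Q h₁ h₂ =>
      obtain ⟨c, X, rfl⟩ := h₁
      obtain ⟨c', X', rfl⟩ := h₂
      exact ⟨c + c', X + X', by rw [add_smul, map_add]; abel⟩
    | smul t P h =>
      obtain ⟨c, X, rfl⟩ := h
      exact ⟨t * c, t • X, by rw [smul_add, mul_smul, map_smul]⟩
    | lie P Q h₁ h₂ =>
      obtain ⟨c, X, rfl⟩ := h₁
      obtain ⟨c', X', rfl⟩ := h₂
      refine ⟨0, c • shiftC X' - c' • shiftC X + ⁅X, X'⁆, ?_⟩
      simp only [add_lie, lie_add, smul_lie, lie_smul, lie_self, smul_zero, zero_smul, zero_add,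
        map_add, map_sub, map_smul, LieHom.map_lie, genA_lie_inclC]
      rw [← lie_skew (inclC X) genA, genA_lie_inclC]
      simp only [smul_neg]
      abel
  obtain ⟨c, X, h⟩ := key P
  have hc : coeffA P = c := by
    rw [h, map_add, map_smul, coeffA_genA, coeffA_inclC, smul_eq_mul, mul_one, add_zero]
  have hX : partC P = X := by
    have h₁ : partC genA = 0 := by
      change (lazard genA).left = 0
      rw [lazard_genA]
    rw [h, map_add, map_smul, h₁, partC_inclC, smul_zero, zero_add]
  rw [hc, hX]
  exact h

/-- The values on `C₁, C₂, …` of the derivation with `a ↦ P`, `b ↦ Q`. -/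
def derC (P Q : LieC) : ℕ → LieC
  | 0 => Q
  | n + 1 => ⁅P, FreeLieAlgebra.of ℚ n⁆ + shiftC (derC P Q n)

theorem der_inclC (D : DerAB) (P Q : LieC) (hP : D genA = inclC P) (hQ : D genB = inclC Q)
    (X : LieC) : D (inclC X) = inclC (freeDerivation (derC P Q) X) := by
  refine freeLie_derivation_ext inclC (D.toLinearMap.comp (inclC : LieC →ₗ[ℚ] LieAB))
    ((inclC : LieC →ₗ[ℚ] LieAB).comp (freeDerivation (derC P Q)).toLinearMap) ?_ ?_ ?_ X
  · intro P Q
    change D (inclC ⁅P, Q⁆) = ⁅inclC P, D (inclC Q)⁆ + ⁅D (inclC P), inclC Q⁆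
    rw [LieHom.map_lie, lieDerivation_lie]
  · intro R S
    change inclC (freeDerivation (derC P Q) ⁅R, S⁆) =
      ⁅inclC R, inclC (freeDerivation (derC P Q) S)⁆ +
        ⁅inclC (freeDerivation (derC P Q) R), inclC S⁆
    rw [lieDerivation_lie, map_add, LieHom.map_lie, LieHom.map_lie]
  · intro n
    change D (inclC (FreeLieAlgebra.of ℚ n)) =
      inclC (freeDerivation (derC P Q) (FreeLieAlgebra.of ℚ n))
    rw [inclC_of, freeDerivation_of]
    induction n with
    | zero => exact hQ
    | succ n ih =>
      rw [adA_succ, lieDerivation_lie, ih, hP, genA_lie_inclC, derC, map_add, LieHom.map_lie,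
        inclC_of, add_comm]

end Associative

/-! ### Sums over the factorisations of a word -/

section SplitSum

variable {K M : Type}

/-- The sum of `H a b` over the factorisations `w = a b`. -/
def splitSum [AddCommMonoid M] (H : List K → List K → M) (w : List K) : M :=
  ∑ i ∈ Finset.range (w.length + 1), H (w.take i) (w.drop i)

/-- `g x c'` if `c = x c'`, and `0` if `c` is empty. -/
def onHead [Zero M] (c : List K) (g : K → List K → M) : M :=
  match c with
  | [] => 0
  | x :: c' => g x c'

/-- `g a' x` if `a = a' x`, and `0` if `a` is empty. -/
def onLast [Zero M] (a : List K) (g : List K → K → M) : M :=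
  match a.reverse with
  | [] => 0
  | x :: a' => g a'.reverse x

theorem onHead_nil [Zero M] (g : K → List K → M) : onHead [] g = 0 := rfl

theorem onHead_cons [Zero M] (x : K) (c : List K) (g : K → List K → M) :
    onHead (x :: c) g = g x c := rfl

theorem onLast_nil [Zero M] (g : List K → K → M) : onLast [] g = 0 := rfl

theorem onLast_concat [Zero M] (a : List K) (x : K) (g : List K → K → M) :
    onLast (a ++ [x]) g = g a x := by
  rw [onLast, List.reverse_append]
  simp

theorem splitSum_congr [AddCommMonoid M] {H H' : List K → List K → M} {w : List K}
    (h : ∀ a b, a ++ b = w → H a b = H' a b) : splitSum H w = splitSum H' w :=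
  Finset.sum_congr rfl fun i _ => h _ _ (List.take_append_drop i w)

theorem splitSum_nil [AddCommMonoid M] (H : List K → List K → M) : splitSum H [] = H [] [] := by
  simp [splitSum]

theorem splitSum_cons [AddCommMonoid M] (H : List K → List K → M) (x : K) (w : List K) :
    splitSum H (x :: w) = H [] (x :: w) + splitSum (fun a b => H (x :: a) b) w := by
  rw [splitSum, List.length_cons, Finset.sum_range_succ', add_comm]
  rfl

theorem splitSum_zero [AddCommMonoid M] (w : List K) :
    splitSum (fun _ _ => (0 : M)) w = 0 := Finset.sum_const_zero

theorem splitSum_add [AddCommMonoid M] (H H' : List K → List K → M) (w : List K) :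
    splitSum (fun a b => H a b + H' a b) w = splitSum H w + splitSum H' w :=
  Finset.sum_add_distrib

theorem splitSum_sub [AddCommGroup M] (H H' : List K → List K → M) (w : List K) :
    splitSum (fun a b => H a b - H' a b) w = splitSum H w - splitSum H' w :=
  Finset.sum_sub_distrib _ _

theorem splitSum_smul {R : Type} [Semiring R] [AddCommMonoid M] [Module R M] (r : R)
    (H : List K → List K → M) (w : List K) :
    splitSum (fun a b => r • H a b) w = r • splitSum H w :=
  Finset.smul_sum.symm

theorem splitSum_mul_left [NonUnitalNonAssocSemiring M] (r : M) (H : List K → List K → M)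
    (w : List K) : splitSum (fun a b => r * H a b) w = r * splitSum H w :=
  (Finset.mul_sum _ _ _).symm

theorem splitSum_left_nil [AddCommMonoid M] (F : List K → M) (w : List K) :
    splitSum (fun a b => if a = [] then F b else 0) w = F w := by
  cases w with
  | nil => rw [splitSum_nil, if_pos rfl]
  | cons x w =>
    rw [splitSum_cons, if_pos rfl]
    simp [splitSum_zero]

theorem splitSum_right_nil [AddCommMonoid M] (F : List K → M) (w : List K) :
    splitSum (fun a b => if b = [] then F a else 0) w = F w := by
  induction w generalizing F with
  | nil => rw [splitSum_nil, if_pos rfl]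
  | cons x w ih => rw [splitSum_cons, if_neg (List.cons_ne_nil x w), zero_add, ih fun a => F (x :: a)]

theorem splitSum_onHead [AddCommMonoid M] (H : K → List K → List K → M) (w : List K) :
    splitSum (fun a b => onHead a fun x a' => H x a' b) w =
      onHead w fun x w' => splitSum (H x) w' := by
  cases w with
  | nil => rw [splitSum_nil]; rfl
  | cons x w => rw [splitSum_cons, onHead_nil, zero_add]; rfl

/-- Moving the last letter of the first factor to the second factor. -/
theorem splitSum_onLast [AddCommMonoid M] (H : List K → K → List K → M) (w : List K) :
    splitSum (fun a b => onLast a fun a' x => H a' x b) w =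
      splitSum (fun a b => onHead b fun x b' => H a x b') w := by
  rw [splitSum, splitSum, Finset.sum_range_succ', Finset.sum_range_succ, List.drop_length,
    List.take_zero, onLast_nil, onHead_nil]
  congr 1
  refine Finset.sum_congr rfl fun i hi => ?_
  rw [Finset.mem_range] at hi
  rw [List.take_succ_eq_append_getElem hi, List.drop_eq_getElem_cons hi, onLast_concat,
    onHead_cons]

theorem onLast_splitSum [AddCommMonoid M] (a : List K) (H : List K → K → List K → List K → M)
    (w : List K) :
    onLast a (fun a' x => splitSum (H a' x) w) =
      splitSum (fun b c => onLast a fun a' x => H a' x b c) w := by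
  rcases List.eq_nil_or_concat a with rfl | ⟨a, x, rfl⟩
  · simp only [onLast_nil, splitSum_zero]
  · simp only [List.concat_eq_append, onLast_concat]

theorem onHead_congr [Zero M] {c : List K} {g g' : K → List K → M}
    (h : ∀ x c', c = x :: c' → g x c' = g' x c') : onHead c g = onHead c g' := by
  cases c with
  | nil => rfl
  | cons x c => exact h x c rfl

theorem onLast_congr [Zero M] {a : List K} {g g' : List K → K → M}
    (h : ∀ a' x, a = a' ++ [x] → g a' x = g' a' x) : onLast a g = onLast a g' := by
  rcases List.eq_nil_or_concat a with rfl | ⟨a, x, rfl⟩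
  · rfl
  · rw [List.concat_eq_append] at *
    rw [onLast_concat, onLast_concat, h a x rfl]

theorem onHead_add [AddZeroClass M] (c : List K) (g g' : K → List K → M) :
    onHead c (fun x c' => g x c' + g' x c') = onHead c g + onHead c g' := by
  cases c with
  | nil => exact (add_zero 0).symm
  | cons x c => rfl

theorem onLast_add [AddZeroClass M] (a : List K) (g g' : List K → K → M) :
    onLast a (fun a' x => g a' x + g' a' x) = onLast a g + onLast a g' := by
  rcases List.eq_nil_or_concat a with rfl | ⟨a, x, rfl⟩
  · exact (add_zero 0).symm
  · simp only [List.concat_eq_append, onLast_concat]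

theorem onHead_sub [SubtractionMonoid M] (c : List K) (g g' : K → List K → M) :
    onHead c (fun x c' => g x c' - g' x c') = onHead c g - onHead c g' := by
  cases c with
  | nil => exact (sub_zero 0).symm
  | cons x c => rfl

theorem onLast_sub [SubtractionMonoid M] (a : List K) (g g' : List K → K → M) :
    onLast a (fun a' x => g a' x - g' a' x) = onLast a g - onLast a g' := by
  rcases List.eq_nil_or_concat a with rfl | ⟨a, x, rfl⟩
  · exact (sub_zero 0).symm
  · simp only [List.concat_eq_append, onLast_concat]

theorem mul_onHead [MulZeroClass M] (r : M) (c : List K) (g : K → List K → M) :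
    r * onHead c g = onHead c fun x c' => r * g x c' := by
  cases c with
  | nil => exact mul_zero r
  | cons x c => rfl

theorem mul_onLast [MulZeroClass M] (r : M) (a : List K) (g : List K → K → M) :
    r * onLast a g = onLast a fun a' x => r * g a' x := by
  rcases List.eq_nil_or_concat a with rfl | ⟨a, x, rfl⟩
  · exact mul_zero r
  · simp only [List.concat_eq_append, onLast_concat]

theorem onHead_const_cons [Zero M] (F : List K → M) (c : List K) :
    onHead c (fun x c' => F (x :: c')) = if c = [] then 0 else F c := by
  cases c with
  | nil => exact (if_pos rfl).symm
  | cons x c => exact (if_neg (List.cons_ne_nil x c)).symm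

theorem onLast_const_concat [Zero M] (F : List K → M) (a : List K) :
    onLast a (fun a' x => F (a' ++ [x])) = if a = [] then 0 else F a := by
  rcases List.eq_nil_or_concat a with rfl | ⟨a, x, rfl⟩
  · exact (if_pos rfl).symm
  · simp [onLast_concat]

end SplitSum

/-! ### Commutative evaluation of noncommutative polynomials -/

section Evaluation

variable {R : Type} [CommRing R]

/-- `C_{i₁} ⋯ C_{i_r}` at the word `x₁ ⋯ x_s`: the value is `∏ (-x_j)^{i_j-1}` if `r = s`, and `0`
otherwise. -/
def evWord : List ℕ → List R → R
  | [], [] => 1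
  | n :: v, x :: w => (-x) ^ n * evWord v w
  | [], _ :: _ => 0
  | _ :: _, [] => 0

theorem map_evWord {S : Type} [CommRing S] (φ : R →+* S) (v : List ℕ) (w : List R) :
    φ (evWord v w) = evWord v (w.map φ) := by
  induction v generalizing w with
  | nil => cases w <;> simp [evWord]
  | cons n v ih => cases w <;> simp [evWord, ih]

variable [Algebra ℚ R]

/-- The evaluation of noncommutative polynomials in the `C_i` at words. -/
def ev : PolyC →ₗ[ℚ] (List R → R) := polyLift evWord

theorem ev_single (v : List ℕ) (w : List R) :
    ev (MonoidAlgebra.single (FreeMonoid.ofList v) 1) w = evWord v w := by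
  rw [ev, polyLift_single, one_smul]

theorem ev_one (w : List R) : ev 1 w = if w = [] then 1 else 0 := by
  rw [← single_nil, ev_single]
  cases w <;> simp [evWord]

theorem ev_letterC_mul (n : ℕ) (f : PolyC) (w : List R) :
    ev (letterC n * f) w = onHead w fun x w' => (-x) ^ n * ev f w' := by
  cases w with
  | nil =>
    have h : ((LinearMap.proj ([] : List R)).comp (ev (R := R))).comp
        (LinearMap.mulLeft ℚ (letterC n)) = 0 := by
      apply polyC_hom_ext
      intro v
      simp only [LinearMap.comp_apply, LinearMap.mulLeft_apply, LinearMap.proj_apply, ← single_cons,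
        ev_single]
      rfl
    exact LinearMap.congr_fun h f
  | cons x w =>
    have h : ((LinearMap.proj (x :: w)).comp (ev (R := R))).comp
        (LinearMap.mulLeft ℚ (letterC n)) =
          (LinearMap.mulLeft ℚ ((-x) ^ n)).comp ((LinearMap.proj w).comp (ev (R := R))) := by
      apply polyC_hom_ext
      intro v
      simp only [LinearMap.comp_apply, LinearMap.mulLeft_apply, LinearMap.proj_apply, ← single_cons,
        ev_single]
      rfl
    exact LinearMap.congr_fun h f

theorem ev_letterC (n : ℕ) (w : List R) :
    ev (letterC n) w = onHead w fun x w' => if w' = [] then (-x) ^ n else 0 := by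
  have h := ev_letterC_mul n 1 w
  rw [mul_one] at h
  rw [h]
  simp only [ev_one, mul_ite, mul_one, mul_zero]

theorem polyC_induction {p : PolyC → Prop} (zero : p 0) (add : ∀ f g, p f → p g → p (f + g))
    (smul : ∀ (c : ℚ) f, p f → p (c • f)) (one : p 1) (letter_mul : ∀ n f, p f → p (letterC n * f))
    (f : PolyC) : p f := by
  induction f using MonoidAlgebra.induction_linear with
  | zero => exact zero
  | add f g hf hg => exact add f g hf hg
  | single m c =>
    have h : (MonoidAlgebra.single m c : PolyC) = c • MonoidAlgebra.single m 1 := by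
      rw [MonoidAlgebra.smul_single, smul_eq_mul, mul_one]
    rw [h]
    apply smul
    change p (MonoidAlgebra.single (FreeMonoid.ofList m.toList) 1)
    induction m.toList with
    | nil => exact one
    | cons n w ih =>
      rw [single_cons]
      exact letter_mul n _ ih

theorem ev_mul (f g : PolyC) (w : List R) :
    ev (f * g) w = splitSum (fun a b => ev f a * ev g b) w := by
  induction f using polyC_induction generalizing w with
  | zero => simp [splitSum_zero]
  | add f f' h h' =>
    simp only [add_mul, map_add, Pi.add_apply, h, h', splitSum_add]
  | smul c f h =>
    simp only [smul_mul_assoc, map_smul, Pi.smul_apply, h, splitSum_smul]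
  | one =>
    rw [one_mul, ← splitSum_left_nil (fun b => ev g b) w]
    refine splitSum_congr fun a b _ => ?_
    rw [ev_one]
    split_ifs <;> simp
  | letter_mul n f h =>
    have h₁ : ∀ a b : List R, ev (letterC n * f) a * ev g b =
        onHead a fun x a' => (-x) ^ n * (ev f a' * ev g b) := by
      intro a b
      rw [ev_letterC_mul, mul_comm, mul_onHead]
      exact onHead_congr fun x c _ => by ring
    simp only [h₁]
    rw [splitSum_onHead, mul_assoc, ev_letterC_mul]
    refine onHead_congr fun x c _ => ?_
    rw [h, splitSum_mul_left]

theorem ev_mul_letterC (n : ℕ) (f : PolyC) (w : List R) :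
    ev (f * letterC n) w = onLast w fun w' x => ev f w' * (-x) ^ n := by
  rw [ev_mul]
  simp only [ev_letterC, mul_onHead]
  rw [← splitSum_onLast (fun a x b => ev f a * if b = [] then (-x) ^ n else 0),
    ← splitSum_right_nil (fun a => onLast a fun w' x => ev f w' * (-x) ^ n) w]
  refine splitSum_congr fun a b _ => ?_
  split_ifs
  · rfl
  · simp only [mul_zero]
    rcases List.eq_nil_or_concat a with rfl | ⟨a, x, rfl⟩
    · rfl
    · simp only [List.concat_eq_append, onLast_concat]

theorem ev_expandC_nil (P : LieC) : ev (expandC P) ([] : List R) = 0 := by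
  induction P using freeLie_induction with
  | of n => rw [expandC_of, ev_letterC]; rfl
  | zero => simp only [map_zero]; rfl
  | add P Q h₁ h₂ => simp only [map_add, Pi.add_apply, h₁, h₂, add_zero]
  | smul c P h => simp only [map_smul, Pi.smul_apply, h, smul_zero]
  | lie P Q h₁ h₂ =>
    rw [expandC_lie, map_sub, Pi.sub_apply, ev_mul, ev_mul, splitSum_nil, splitSum_nil, h₁, h₂,
      sub_self]

theorem ev_shiftC (X : LieC) (w : List R) :
    ev (expandC (shiftC X)) w = -w.sum * ev (expandC X) w := by
  rw [shiftC, expandC_freeDerivation]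
  simp only [expandC_of]
  induction expandC X using polyC_induction generalizing w with
  | zero => simp only [map_zero, Pi.zero_apply, mul_zero]
  | add f g hf hg => simp only [map_add, Pi.add_apply, hf, hg, mul_add]
  | smul c f h => simp only [map_smul, Pi.smul_apply, h, mul_smul_comm]
  | one =>
    rw [polyDer_one, map_zero, ev_one]
    cases w <;> simp
  | letter_mul n f h =>
    rw [polyDer_cons, map_add, Pi.add_apply, ev_letterC_mul, ev_letterC_mul, ev_letterC_mul]
    cases w with
    | nil => simp [onHead_nil]
    | cons x w =>
      simp only [onHead_cons, h, List.sum_cons]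
      ring

theorem map_ev {S : Type} [CommRing S] [Algebra ℚ S] (φ : R →ₐ[ℚ] S) (f : PolyC) (w : List R) :
    φ (ev f w) = ev f (w.map φ) := by
  have h : φ.toLinearMap.comp ((LinearMap.proj w).comp (ev (R := R))) =
      (LinearMap.proj (w.map φ)).comp (ev (R := S)) := by
    apply polyC_hom_ext
    intro v
    simp only [LinearMap.comp_apply, LinearMap.proj_apply, ev_single]
    exact map_evWord (φ : R →+* S) v w
  exact LinearMap.congr_fun h f

end Evaluation

/-! ### Derivations in terms of moulds -/

section Derivation

variable {K : Type} [Field K]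

/-- No nonempty factor of the word has sum zero. -/
def GoodWord (w : List K) : Prop := ∀ v, v <:+: w → v ≠ [] → v.sum ≠ 0

theorem GoodWord.infix {v w : List K} (hw : GoodWord w) (h : v <:+: w) : GoodWord v :=
  fun u hu => hw u (hu.trans h)

theorem GoodWord.mem_ne_zero {w : List K} (hw : GoodWord w) {x : K} (hx : x ∈ w) : x ≠ 0 := by
  obtain ⟨a, b, rfl⟩ := List.append_of_mem hx
  have h := hw [x] ⟨a, b, by simp⟩ (by simp)
  simpa using h

theorem GoodWord.prod_ne_zero {w : List K} (hw : GoodWord w) : w.prod ≠ 0 :=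
  List.prod_ne_zero fun h => hw.mem_ne_zero h rfl

/-- Let `D` be the derivation with `D(a) = p` which kills `[a, b]`. If `φ(y)` is the value of a word
containing one factor `C_i` evaluated at `y`, then this is the value of the word with `D(C_i)`
instead of `C_i`, evaluated at `b` instead of `y`. -/
def substWord (p : List K → K) (b : List K) (φ : K → K) : K :=
  onLast b (fun b' x => p b' / b'.sum * (φ x - x / (b'.sum + x) * φ (b'.sum + x))) -
    onHead b fun x b' => p b' / b'.sum * (φ x - x / (x + b'.sum) * φ (x + b'.sum))

theorem substWord_add (p : List K → K) (b : List K) (φ ψ : K → K) :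
    substWord p b (fun y => φ y + ψ y) = substWord p b φ + substWord p b ψ := by
  rw [substWord, substWord, substWord, sub_add_sub_comm, ← onHead_add, ← onLast_add]
  congr 1
  · exact onLast_congr fun _ _ _ => by ring
  · exact onHead_congr fun _ _ _ => by ring

theorem substWord_mul (p : List K → K) (b : List K) (r : K) (φ : K → K) :
    substWord p b (fun y => r * φ y) = r * substWord p b φ := by
  rw [substWord, substWord, mul_sub, mul_onLast, mul_onHead]
  congr 1
  · exact onLast_congr fun _ _ _ => by ring
  · exact onHead_congr fun _ _ _ => by ring

theorem substWord_zero (p : List K → K) (b : List K) : substWord p b (fun _ => 0) = 0 := by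
  simpa using substWord_mul p b 0 fun _ => 0

variable [Algebra ℚ K]

theorem ev_derC {P Q : LieC} (hPQ : ⁅P, FreeLieAlgebra.of ℚ 0⁆ + shiftC Q = 0) (n : ℕ)
    {b : List K} (hb : GoodWord b) :
    ev (expandC (derC P Q n)) b = substWord (ev (expandC P)) b fun y => (-y) ^ n := by
  have hlu : ∀ n, ev (expandC ⁅P, FreeLieAlgebra.of ℚ n⁆) b =
      onLast b (fun b' x => ev (expandC P) b' * (-x) ^ n) -
        onHead b fun x b' => ev (expandC P) b' * (-x) ^ n := by
    intro n
    rw [expandC_lie, expandC_of, map_sub, Pi.sub_apply, ev_mul_letterC, ev_letterC_mul]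
    congr 1
    exact onHead_congr fun _ _ _ => mul_comm _ _
  have hdiv : ∀ b' : List K, b' <:+: b →
      ev (expandC P) b' = ev (expandC P) b' / b'.sum * b'.sum := by
    intro b' h
    rcases eq_or_ne b' [] with rfl | h'
    · rw [ev_expandC_nil, zero_div, zero_mul]
    · rw [div_mul_cancel₀ _ (hb b' h h')]
  have hlast : ∀ b' x, b = b' ++ [x] → b' <:+: b ∧ b'.sum + x ≠ 0 := by
    rintro b' x rfl
    refine ⟨⟨[], [x], rfl⟩, ?_⟩
    have := hb _ List.infix_rfl (by simp)
    simpa using this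
  have hhead : ∀ x b', b = x :: b' → b' <:+: b ∧ x + b'.sum ≠ 0 := by
    rintro x b' rfl
    refine ⟨⟨[x], [], by simp⟩, ?_⟩
    have := hb _ List.infix_rfl (by simp)
    simpa using this
  have hsum : ∀ n, b.sum * substWord (ev (expandC P)) b (fun y => (-y) ^ n) =
      onLast b (fun b' x => (b'.sum + x) * (ev (expandC P) b' / b'.sum *
        ((-x) ^ n - x / (b'.sum + x) * (-(b'.sum + x)) ^ n))) -
      onHead b (fun x b' => (x + b'.sum) * (ev (expandC P) b' / b'.sum *
        ((-x) ^ n - x / (x + b'.sum) * (-(x + b'.sum)) ^ n))) := by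
    intro n
    rw [substWord, mul_sub, mul_onLast, mul_onHead]
    congr 1
    · refine onLast_congr fun b' x h => ?_
      rw [h]; simp
    · refine onHead_congr fun x b' h => ?_
      rw [h]; simp
  induction n with
  | zero =>
    rw [derC]
    rcases eq_or_ne b [] with rfl | hne
    · rw [ev_expandC_nil]
      simp [substWord, onLast_nil, onHead_nil]
    · have h := congrFun (congrArg (fun X => ev (R := K) (expandC X)) hPQ) b
      simp only [map_add, Pi.add_apply, map_zero, Pi.zero_apply, ev_shiftC, hlu] at h
      apply mul_left_cancel₀ (hb b List.infix_rfl hne)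
      rw [hsum, neg_mul, add_neg_eq_zero] at *
      rw [← h]
      congr 1
      · refine onLast_congr fun b' x h => ?_
        obtain ⟨h₁, h₂⟩ := hlast b' x h
        nth_rewrite 1 [hdiv b' h₁]
        generalize ev (expandC P) b' / b'.sum = q
        generalize b'.sum = s at *
        field_simp
        ring
      · refine onHead_congr fun x b' h => ?_
        obtain ⟨h₁, h₂⟩ := hhead x b' h
        nth_rewrite 1 [hdiv b' h₁]
        generalize ev (expandC P) b' / b'.sum = q
        generalize b'.sum = s at *
        field_simp
        ring
  | succ n ih =>
    rw [derC, map_add, map_add, Pi.add_apply, ev_shiftC, hlu, ih, neg_mul, hsum, ← sub_eq_add_neg,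
      sub_sub_sub_comm, ← onLast_sub, ← onHead_sub, substWord]
    congr 1
    · refine onLast_congr fun b' x h => ?_
      obtain ⟨h₁, h₂⟩ := hlast b' x h
      nth_rewrite 1 [hdiv b' h₁]
      generalize ev (expandC P) b' / b'.sum = q
      generalize b'.sum = s at *
      field_simp
      ring
    · refine onHead_congr fun x b' h => ?_
      obtain ⟨h₁, h₂⟩ := hhead x b' h
      nth_rewrite 1 [hdiv b' h₁]
      generalize ev (expandC P) b' / b'.sum = q
      generalize b'.sum = s at *
      field_simp
      ring

/-- The action on functions of words of the derivation with `D(a) = p` which kills `[a, b]`. -/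
def derMould (p F : List K → K) (w : List K) : K :=
  splitSum (fun a v => splitSum (fun b c => substWord p b fun y => F (a ++ y :: c)) v) w

theorem ev_polyDer (g : ℕ → PolyC) (p : List K → K)
    (hg : ∀ n b, GoodWord b → ev (g n) b = substWord p b fun y => (-y) ^ n) (f : PolyC)
    {w : List K} (hw : GoodWord w) : ev (polyDer g f) w = derMould p (ev f) w := by
  induction f using polyC_induction generalizing w with
  | zero => simp only [map_zero, Pi.zero_apply, derMould, substWord_zero, splitSum_zero]
  | add f f' h h' =>
    simp only [map_add, Pi.add_apply, h hw, h' hw, derMould, substWord_add, splitSum_add]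
  | smul c f h =>
    simp only [map_smul, Pi.smul_apply, h hw, derMould]
    simp only [Algebra.smul_def, substWord_mul, splitSum_mul_left]
  | one =>
    have h : ∀ (a c : List K) (y : K), ev 1 (a ++ y :: c) = (0 : K) := fun a c y => by
      rw [ev_one, if_neg (by simp)]
    simp only [polyDer_one, map_zero, Pi.zero_apply, derMould, h, substWord_zero, splitSum_zero]
  | letter_mul n f h =>
    rw [polyDer_cons, map_add, Pi.add_apply, ev_letterC_mul]
    cases w with
    | nil =>
      rw [ev_mul, splitSum_nil, hg n [] hw, derMould, splitSum_nil, splitSum_nil]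
      simp [substWord, onLast_nil, onHead_nil]
    | cons x w =>
      have hw' : GoodWord w := hw.infix ⟨[x], [], by simp⟩
      rw [derMould, splitSum_cons, onHead_cons, h hw', ev_mul, derMould, ← splitSum_mul_left]
      congr 1
      · refine splitSum_congr fun b c hbc => ?_
        simp only [List.nil_append, ev_letterC_mul, onHead_cons]
        rw [hg n b (hw.infix ⟨[], c, hbc⟩), mul_comm, ← substWord_mul]
        congr 1
        funext y
        ring
      · congr 1
        funext a v
        rw [← splitSum_mul_left]
        congr 1
        funext b c
        simp only [List.cons_append, ev_letterC_mul, onHead_cons, substWord_mul]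

end Derivation

section Arit

variable {K : Type} [Field K]

/-- The operation `arit(A) · B` on functions of words. -/
def aritWord (A B : List K → K) (w : List K) : K :=
  splitSum (fun a v => splitSum (fun b c => A b *
    (onHead c (fun x c' => B (a ++ (b.sum + x) :: c')) -
      onLast a fun a' x => B (a' ++ (x + b.sum) :: c))) v) w

theorem derMould_eq (p F : List K → K) (w : List K) :
    derMould p F w = splitSum (fun a v => splitSum (fun b c => p b / b.sum *
      (onHead c (fun x c' => F (a ++ x :: c') - x / (b.sum + x) * F (a ++ (b.sum + x) :: c')) -
        onLast a fun a' x => F (a' ++ x :: c) - x / (x + b.sum) * F (a' ++ (x + b.sum) :: c))) v)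
      w := by
  simp only [derMould, substWord, mul_sub _ (onHead _ _), splitSum_sub]
  congr 1
  · refine splitSum_congr fun a v _ => ?_
    have h : ∀ b c : List K, p b / b.sum * onHead c (fun x c' => F (a ++ x :: c') -
        x / (b.sum + x) * F (a ++ (b.sum + x) :: c')) = onHead c fun x c' => p b / b.sum *
        (F (a ++ x :: c') - x / (b.sum + x) * F (a ++ (b.sum + x) :: c')) :=
      fun b c => mul_onHead _ _ _
    simp only [h]
    exact splitSum_onLast (fun b x c => p b / b.sum *
        (F (a ++ x :: c) - x / (b.sum + x) * F (a ++ (b.sum + x) :: c))) v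
  · have h : ∀ a b c : List K, p b / b.sum * onLast a (fun a' x => F (a' ++ x :: c) -
        x / (x + b.sum) * F (a' ++ (x + b.sum) :: c)) = onLast a fun a' x => p b / b.sum *
        (F (a' ++ x :: c) - x / (x + b.sum) * F (a' ++ (x + b.sum) :: c)) :=
      fun a b c => mul_onLast _ _ _
    simp only [h]
    have h' : ∀ a v : List K, splitSum (fun b c => onLast a fun a' x => p b / b.sum *
        (F (a' ++ x :: c) - x / (x + b.sum) * F (a' ++ (x + b.sum) :: c))) v =
          onLast a fun a' x => splitSum (fun b c => p b / b.sum *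
            (F (a' ++ x :: c) - x / (x + b.sum) * F (a' ++ (x + b.sum) :: c))) v :=
      fun a v => (onLast_splitSum a (fun a' x b c => p b / b.sum *
        (F (a' ++ x :: c) - x / (x + b.sum) * F (a' ++ (x + b.sum) :: c))) v).symm
    refine Eq.trans ?_ (splitSum_congr fun a v _ => (h' a v).symm)
    rw [splitSum_onLast fun a x v => splitSum (fun b c => p b / b.sum *
        (F (a ++ x :: c) - x / (x + b.sum) * F (a ++ (x + b.sum) :: c))) v]
    refine splitSum_congr fun a v _ => ?_
    exact splitSum_onHead (fun x b c => p b / b.sum *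
        (F (a ++ x :: c) - x / (x + b.sum) * F (a ++ (x + b.sum) :: c))) v

/-- `F` is `A` multiplied by `u₁ ⋯ u_r (u₁ + ⋯ + u_r)`. -/
structure IsDeltaMul (F A : List K → K) : Prop where
  left_nil : F [] = 0
  right_nil : A [] = 0
  eq_mul : ∀ w : List K, w.prod ≠ 0 → w.sum ≠ 0 → F w = w.prod * w.sum * A w

theorem IsDeltaMul.eq_mul_of_good {F A : List K → K} (h : IsDeltaMul F A) {w : List K}
    (hw : GoodWord w) : F w = w.prod * w.sum * A w := by
  rcases eq_or_ne w [] with rfl | hne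
  · rw [h.left_nil, h.right_nil, mul_zero]
  · exact h.eq_mul w hw.prod_ne_zero (hw w List.infix_rfl hne)

theorem IsDeltaMul.div_sum {F A : List K → K} (h : IsDeltaMul F A) {w : List K}
    (hw : GoodWord w) : F w / w.sum = w.prod * A w := by
  rcases eq_or_ne w [] with rfl | hne
  · rw [h.left_nil, h.right_nil, mul_zero, zero_div]
  · rw [h.eq_mul_of_good hw]
    have := hw w List.infix_rfl hne
    field_simp

/-- The derivation `D₁` with `Ψ(D₁) = A` applied to `D₂(a)`, where `Ψ(D₂) = B`. -/
theorem derMould_isDeltaMul {p F A B : List K → K} (hp : IsDeltaMul p A) (hF : IsDeltaMul F B)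
    {w : List K} (hw : GoodWord w) :
    derMould p F w = w.prod * splitSum (fun b c => c.sum * (A b * B c) - b.sum * (B b * A c)) w -
      w.prod * w.sum * aritWord A B w := by
  have hterm : ∀ a b c : List K, a ++ (b ++ c) = w → p b / b.sum *
      (onHead c (fun x c' => F (a ++ x :: c') - x / (b.sum + x) * F (a ++ (b.sum + x) :: c')) -
        onLast a fun a' x => F (a' ++ x :: c) - x / (x + b.sum) * F (a' ++ (x + b.sum) :: c)) =
      ((if a = [] then b.prod * A b * F c else 0) - if c = [] then b.prod * A b * F a else 0) -
        w.prod * w.sum * (A b * (onHead c (fun x c' => B (a ++ (b.sum + x) :: c')) -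
          onLast a fun a' x => B (a' ++ (x + b.sum) :: c))) := by
    intro a b c habc
    have hS : w.sum ≠ 0 ∨ w = [] := by
      rcases eq_or_ne w [] with h | h
      · exact Or.inr h
      · exact Or.inl (hw w List.infix_rfl h)
    rcases hS with hS | rfl
    swap
    · simp only [List.append_eq_nil_iff] at habc
      obtain ⟨rfl, rfl, rfl⟩ := habc
      simp [onHead_nil, onLast_nil]
    have hprod := hw.prod_ne_zero
    rw [hp.div_sum (hw.infix ⟨a, c, by rw [List.append_assoc, habc]⟩), onHead_sub, onLast_sub]
    have h₁ : onHead c (fun x c' => F (a ++ x :: c')) = if c = [] then 0 else F (a ++ c) :=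
      onHead_const_cons (fun c => F (a ++ c)) c
    have h₂ : onLast a (fun a' x => F (a' ++ x :: c)) = if a = [] then 0 else F (a ++ c) := by
      rw [← onLast_const_concat (fun a => F (a ++ c)) a]
      simp only [List.append_assoc, List.singleton_append]
    have h₃ : b.prod * A b * onHead c (fun x c' => x / (b.sum + x) * F (a ++ (b.sum + x) :: c')) =
        w.prod * w.sum * (A b * onHead c (fun x c' => B (a ++ (b.sum + x) :: c'))) := by
      rw [mul_onHead, mul_onHead, mul_onHead]
      refine onHead_congr fun x c' hc => ?_
      subst hc habc
      have hx : b.sum + x ≠ 0 := by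
        have := hw (b ++ [x]) ⟨a, c', by simp⟩ (by simp)
        simpa using this
      simp only [List.prod_append, List.prod_cons, List.sum_append, List.sum_cons] at hprod hS
      rw [hF.eq_mul (a ++ (b.sum + x) :: c')]
      · simp only [List.prod_append, List.prod_cons, List.sum_append, List.sum_cons]
        field_simp
        ring
      · simp only [List.prod_append, List.prod_cons]
        simp only [ne_eq, mul_eq_zero, not_or] at hprod
        exact mul_ne_zero hprod.1 (mul_ne_zero hx hprod.2.2.2)
      · simp only [List.sum_append, List.sum_cons]
        rwa [add_assoc]
    have h₄ : b.prod * A b * onLast a (fun a' x => x / (x + b.sum) * F (a' ++ (x + b.sum) :: c)) =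
        w.prod * w.sum * (A b * onLast a (fun a' x => B (a' ++ (x + b.sum) :: c))) := by
      rw [mul_onLast, mul_onLast, mul_onLast]
      refine onLast_congr fun a' x ha => ?_
      subst ha habc
      have hx : x + b.sum ≠ 0 := by
        have := hw (x :: b) ⟨a', c, by simp⟩ (by simp)
        simpa using this
      simp only [List.prod_append, List.prod_cons, List.prod_nil, List.sum_append, List.sum_cons,
        List.sum_nil, mul_one, add_zero] at hprod hS
      rw [hF.eq_mul (a' ++ (x + b.sum) :: c)]
      · simp only [List.prod_append, List.prod_cons, List.prod_nil, List.sum_append, List.sum_cons,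
          List.sum_nil]
        field_simp
        ring
      · simp only [List.prod_append, List.prod_cons]
        simp only [ne_eq, mul_eq_zero, not_or] at hprod
        exact mul_ne_zero hprod.1.1 (mul_ne_zero hx hprod.2.2)
      · simp only [List.sum_append, List.sum_cons]
        rwa [add_assoc, ← add_assoc] at *
    rw [sub_sub_sub_comm, mul_sub, mul_sub, mul_sub, h₃, h₄, h₁, h₂]
    rcases eq_or_ne a [] with rfl | ha <;> rcases eq_or_ne c [] with rfl | hc
    · simp [onHead_nil, onLast_nil]
    · simp [hc, onLast_nil]
    · simp [ha, onHead_nil]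
    · simp [ha, hc]
      ring
  have hsum : derMould p F w = splitSum (fun a v => splitSum (fun b c =>
      ((if a = [] then b.prod * A b * F c else 0) - if c = [] then b.prod * A b * F a else 0) -
        w.prod * w.sum * (A b * (onHead c (fun x c' => B (a ++ (b.sum + x) :: c')) -
          onLast a fun a' x => B (a' ++ (x + b.sum) :: c)))) v) w := by
    rw [derMould_eq]
    refine splitSum_congr fun a v hv => splitSum_congr fun b c hc => ?_
    exact hterm a b c (by rw [hc, hv])
  rw [hsum]
  simp only [splitSum_sub, splitSum_mul_left]
  congr 1
  have h₁ : splitSum (fun a v => splitSum (fun b c =>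
      if a = [] then b.prod * A b * F c else 0) v) w =
        splitSum (fun b c => b.prod * A b * F c) w := by
    rw [← splitSum_left_nil (fun v => splitSum (fun b c => b.prod * A b * F c) v) w]
    refine splitSum_congr fun a v _ => ?_
    split_ifs
    · rfl
    · exact splitSum_zero v
  have h₂ : splitSum (fun a v => splitSum (fun b c =>
      if c = [] then b.prod * A b * F a else 0) v) w =
        splitSum (fun a b => b.prod * A b * F a) w :=
    splitSum_congr fun a v _ => splitSum_right_nil (fun b => b.prod * A b * F a) v
  rw [h₁, h₂, mul_sub, ← splitSum_mul_left, ← splitSum_mul_left]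
  congr 1
  · refine splitSum_congr fun b c hbc => ?_
    rw [hF.eq_mul_of_good (hw.infix ⟨b, [], by rw [List.append_nil, hbc]⟩), ← hbc,
      List.prod_append]
    ring
  · refine splitSum_congr fun b c hbc => ?_
    rw [hF.eq_mul_of_good (hw.infix ⟨[], c, hbc⟩), ← hbc, List.prod_append]
    ring

/-- The commutator of two derivations corresponds to the ari-bracket. -/
theorem derMould_sub_derMould {F₁ F₂ A B : List K → K} (h₁ : IsDeltaMul F₁ A)
    (h₂ : IsDeltaMul F₂ B) {w : List K} (hw : GoodWord w) :
    derMould F₁ F₂ w - derMould F₂ F₁ w = w.prod * w.sum *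
      (aritWord B A w - aritWord A B w +
        (splitSum (fun b c => A b * B c) w - splitSum (fun b c => B b * A c) w)) := by
  rw [derMould_isDeltaMul h₁ h₂ hw, derMould_isDeltaMul h₂ h₁ hw]
  have h : splitSum (fun b c => c.sum * (A b * B c) - b.sum * (B b * A c)) w -
      splitSum (fun b c => c.sum * (B b * A c) - b.sum * (A b * B c)) w =
      w.sum * (splitSum (fun b c => A b * B c) w - splitSum (fun b c => B b * A c) w) := by
    rw [← splitSum_sub, ← splitSum_sub, ← splitSum_mul_left]
    refine splitSum_congr fun b c hbc => ?_
    rw [← hbc, List.sum_append]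
    ring
  linear_combination w.prod * h

end Arit

/-! ### Values of rational functions -/

theorem evalRat_div {s : ℕ} {K : Type} [Field K] [Algebra ℚ K] (x : Fin s → K)
    (p q : MvPolynomial (Fin s) ℚ) (hq : MvPolynomial.aeval x q ≠ 0) :
    evalRat x (algebraMap _ (RatFun s) p / algebraMap _ (RatFun s) q) =
      MvPolynomial.aeval x p / MvPolynomial.aeval x q := by
  set F : RatFun s := algebraMap _ (RatFun s) p / algebraMap _ (RatFun s) q with hF
  have hq0 : q ≠ 0 := by rintro rfl; exact hq (map_zero _)
  have hinj := IsFractionRing.injective (MvPolynomial (Fin s) ℚ) (RatFun s)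
  have hq1 : algebraMap _ (RatFun s) q ≠ 0 := by
    rwa [ne_eq, map_eq_zero_iff _ hinj]
  have hd1 : algebraMap _ (RatFun s) (IsFractionRing.den (MvPolynomial (Fin s) ℚ) F :
      MvPolynomial (Fin s) ℚ) ≠ 0 := by
    rw [ne_eq, map_eq_zero_iff _ hinj]
    exact nonZeroDivisors.coe_ne_zero _
  have hcross : IsFractionRing.num (MvPolynomial (Fin s) ℚ) F * q =
      p * (IsFractionRing.den (MvPolynomial (Fin s) ℚ) F : MvPolynomial (Fin s) ℚ) := by
    apply hinj
    rw [map_mul, map_mul, ← div_eq_div_iff hd1 hq1, IsFractionRing.mk'_num_den']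
  have hdvd : (IsFractionRing.den (MvPolynomial (Fin s) ℚ) F : MvPolynomial (Fin s) ℚ) ∣ q :=
    (IsFractionRing.num_den_reduced (MvPolynomial (Fin s) ℚ) F).symm.dvd_of_dvd_mul_left
      ⟨p, by rw [hcross, mul_comm]⟩
  obtain ⟨t, ht⟩ := hdvd
  have hden : MvPolynomial.aeval x
      (IsFractionRing.den (MvPolynomial (Fin s) ℚ) F : MvPolynomial (Fin s) ℚ) ≠ 0 := by
    intro h
    apply hq
    rw [ht, map_mul, h, zero_mul]
  rw [evalRat, div_eq_div_iff hden hq, ← map_mul, hcross, map_mul]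

theorem evalRat_zero {s : ℕ} {K : Type} [Field K] [Algebra ℚ K] (x : Fin s → K) :
    evalRat x (0 : RatFun s) = 0 := by
  have h := evalRat_div x 0 1 (by rw [map_one]; exact one_ne_zero)
  rwa [map_zero, map_zero, zero_div, zero_div] at h

theorem atWord_nil {K : Type} [Field K] [Algebra ℚ K] (A : ARI) :
    atWord (A : Mould) ([] : List K) = 0 := by
  have h : (A : Mould) 0 = 0 := A.2
  change evalRat _ ((A : Mould) 0) = 0
  rw [h]
  exact evalRat_zero _

/-! ### The map `ma` through evaluation -/

theorem evWord_of_length_ne {R : Type} [CommRing R] {v : List ℕ} {w : List R}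
    (h : v.length ≠ w.length) : evWord v w = 0 := by
  induction v generalizing w with
  | nil => cases w with
    | nil => exact absurd rfl h
    | cons x w => rfl
  | cons n v ih => cases w with
    | nil => rfl
    | cons x w =>
      rw [evWord, ih (fun h' => h (by rw [List.length_cons, List.length_cons, h'])), mul_zero]

theorem evWord_ofFn {R : Type} [CommRing R] {r : ℕ} (y : Fin r → ℕ) (x : Fin r → R) :
    evWord (List.ofFn y) (List.ofFn x) = (-1) ^ (∑ j, y j) * ∏ j, x j ^ y j := by
  induction r with
  | zero => simp [evWord]
  | succ r ih =>
    rw [List.ofFn_succ, List.ofFn_succ, evWord, ih, Fin.prod_univ_succ, Fin.sum_univ_succ, neg_pow,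
      pow_add]
    ring

theorem length_genericWord (r : ℕ) : (genericWord r).length = r := List.length_ofFn

theorem maPoly_apply (f : PolyC) (r : ℕ) : maPoly f r = ev f (genericWord r) := by
  have h : (LinearMap.proj r).comp maPoly =
      (LinearMap.proj (genericWord r)).comp (ev (R := RatFun r)) := by
    apply polyC_hom_ext
    intro v
    simp only [LinearMap.comp_apply, LinearMap.proj_apply, ev_single]
    change polyLift maWord _ r = _
    rw [polyLift_single, one_smul, maWord]
    rcases eq_or_ne r v.length with rfl | hr
    · have h := evWord_ofFn v.get (var (r := v.length))
      rw [List.ofFn_get, ← List.sum_ofFn, List.ofFn_get] at h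
      rw [Pi.single_eq_same, genericWord, h]
    · rw [Pi.single_eq_of_ne hr, evWord_of_length_ne]
      rw [length_genericWord]
      exact hr.symm
  exact LinearMap.congr_fun h f

theorem ma_apply (P : LieAB) (r : ℕ) : ma P r = ev (expandC (partC P)) (genericWord r) :=
  maPoly_apply _ r

/-- The word `(u₁, …, u_r)` of polynomials. -/
def polyWord (r : ℕ) : List (MvPolynomial (Fin r) ℚ) := List.ofFn MvPolynomial.X

/-- The embedding `ℚ[u₁, …, u_r] → ℚ(u₁, …, u_r)`. -/
def polyToRat (r : ℕ) : MvPolynomial (Fin r) ℚ →ₐ[ℚ] RatFun r :=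
  { algebraMap (MvPolynomial (Fin r) ℚ) (RatFun r) with
    commutes' := fun c => by
      change ((algebraMap (MvPolynomial (Fin r) ℚ) (RatFun r)).comp (algebraMap ℚ _)) c = _
      exact RingHom.congr_fun (Subsingleton.elim _ _) c }

theorem polyToRat_injective (r : ℕ) : Function.Injective (polyToRat r) :=
  IsFractionRing.injective (MvPolynomial (Fin r) ℚ) (RatFun r)

theorem map_polyWord (r : ℕ) : (polyWord r).map (polyToRat r) = genericWord r := by
  rw [polyWord, List.map_ofFn]
  rfl

theorem ev_genericWord (f : PolyC) (r : ℕ) :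
    ev f (genericWord r) = polyToRat r (ev f (polyWord r)) := by
  rw [map_ev, map_polyWord]

theorem Delta_eq (r : ℕ) : Delta r = (genericWord r).prod * (genericWord r).sum := by
  rw [Delta, genericWord, List.prod_ofFn, List.sum_ofFn]

theorem goodWord_genericWord (r : ℕ) : GoodWord (genericWord r) := by
  intro v hv hne h
  obtain ⟨a, b, hab⟩ := hv
  rw [← map_polyWord, List.append_eq_map_iff] at hab
  obtain ⟨l, b', hl, hlv, -⟩ := hab
  obtain ⟨l₁, l₂, rfl, -, rfl⟩ := List.map_eq_append_iff.1 hlv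
  rw [← map_list_sum, map_eq_zero_iff _ (polyToRat_injective r)] at h
  have hl₂ : ∀ p ∈ l₂, MvPolynomial.aeval (fun _ : Fin r => (1 : ℚ)) p = 1 := by
    intro p hp
    have hp' : p ∈ polyWord r := by
      rw [hl]
      simp [hp]
    rw [polyWord, List.mem_ofFn] at hp'
    obtain ⟨j, rfl⟩ := hp'
    exact MvPolynomial.aeval_X _ _
  have h' := congrArg (MvPolynomial.aeval (fun _ : Fin r => (1 : ℚ))) h
  rw [map_list_sum, List.map_congr_left hl₂, map_zero] at h'
  apply hne
  simpa using h'

theorem atWord_Da {K : Type} [Field K] [Algebra ℚ K] (P : LieAB) {w : List K}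
    (hprod : w.prod ≠ 0) (hsum : w.sum ≠ 0) :
    atWord (Da P : Mould) w = ev (expandC (partC P)) w / (w.prod * w.sum) := by
  have hlen : w.length ≠ 0 := by
    intro h
    rw [List.length_eq_zero_iff] at h
    rw [h] at hsum
    exact hsum List.sum_nil
  have hw : (polyWord w.length).map (MvPolynomial.aeval w.get : _ →ₐ[ℚ] K) = w := by
    rw [polyWord, List.map_ofFn]
    conv_rhs => rw [← List.ofFn_get w]
    congr 1
    funext j
    exact MvPolynomial.aeval_X _ _
  have hval : (Da P : Mould) w.length =
      algebraMap _ (RatFun w.length) (ev (expandC (partC P)) (polyWord w.length)) /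
        algebraMap _ (RatFun w.length) ((polyWord w.length).prod * (polyWord w.length).sum) := by
    change (if w.length = 0 then 0 else ma P w.length / Delta w.length) = _
    rw [if_neg hlen, ma_apply, ev_genericWord, Delta_eq, ← map_polyWord, ← map_list_prod,
      ← map_list_sum, ← map_mul]
    rfl
  have hΔ : MvPolynomial.aeval w.get ((polyWord w.length).prod * (polyWord w.length).sum) =
      w.prod * w.sum := by
    rw [map_mul, map_list_prod, map_list_sum, hw]
  rw [atWord, hval, evalRat_div, hΔ, map_ev, hw]
  rw [hΔ]
  exact mul_ne_zero hprod hsum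

theorem isDeltaMul_Da {K : Type} [Field K] [Algebra ℚ K] (P : LieAB) :
    IsDeltaMul (K := K) (ev (expandC (partC P))) (atWord (Da P : Mould)) where
  left_nil := ev_expandC_nil _
  right_nil := atWord_nil _
  eq_mul w h h' := by
    rw [atWord_Da P h h']
    field_simp

/-! ### The ari-bracket as a sum over factorisations -/

theorem splitSum_splitSum {K M : Type} [AddCommMonoid M] (H : List K → List K → List K → M)
    (w : List K) :
    splitSum (fun a v => splitSum (fun b c => H a b c) v) w =
      ∑ k ∈ Finset.range (w.length + 1), ∑ l ∈ Finset.Icc k w.length,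
        H (w.take k) ((w.take l).drop k) (w.drop l) := by
  refine Finset.sum_congr rfl fun k hk => ?_
  rw [Finset.mem_range] at hk
  change ∑ i ∈ Finset.range ((w.drop k).length + 1), _ = _
  rw [List.length_drop, ← Finset.Ico_add_one_right_eq_Icc, Finset.sum_Ico_eq_sum_range,
    show w.length + 1 - k = w.length - k + 1 by omega]
  refine Finset.sum_congr rfl fun i _ => ?_
  rw [List.drop_take, List.drop_drop, Nat.add_sub_cancel_left]

theorem sum_range_Ioo_eq_splitSum {K M : Type} [AddCommMonoid M]
    (H H' : List K → List K → List K → M) (w : List K)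
    (h : ∀ a b c, b ≠ [] → c ≠ [] → H a b c = H' a b c) (hb : ∀ a c, H' a [] c = 0)
    (hc : ∀ a b, H' a b [] = 0) :
    ∑ k ∈ Finset.range w.length, ∑ l ∈ Finset.Ioo k w.length,
        H (w.take k) ((w.take l).drop k) (w.drop l) =
      splitSum (fun a v => splitSum (fun b c => H' a b c) v) w := by
  rw [splitSum_splitSum, Finset.sum_range_succ, Finset.Icc_self, Finset.sum_singleton,
    List.drop_length, hc, add_zero]
  refine Finset.sum_congr rfl fun k _ => ?_
  have hsub : Finset.Ioo k w.length ⊆ Finset.Icc k w.length := Finset.Ioo_subset_Icc_self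
  rw [← Finset.sum_subset hsub]
  · refine Finset.sum_congr rfl fun l hl => h _ _ _ ?_ ?_
    · rw [Finset.mem_Ioo] at hl
      simp only [ne_eq, List.drop_eq_nil_iff, List.length_take]
      omega
    · rw [Finset.mem_Ioo] at hl
      simp only [ne_eq, List.drop_eq_nil_iff]
      omega
  · intro l hl hl'
    rw [Finset.mem_Icc] at hl
    rw [Finset.mem_Ioo] at hl'
    rcases eq_or_ne l k with rfl | hlk
    · rw [List.drop_take, Nat.sub_self, List.take_zero, hb]
    · rw [show l = w.length by omega, List.drop_length, hc]

theorem sum_Icc_Ioc_eq_splitSum {K M : Type} [AddCommMonoid M]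
    (H H' : List K → List K → List K → M) (w : List K)
    (h : ∀ a b c, a ≠ [] → b ≠ [] → H a b c = H' a b c) (ha : ∀ b c, H' [] b c = 0)
    (hb : ∀ a c, H' a [] c = 0) :
    ∑ k ∈ Finset.Icc 1 w.length, ∑ l ∈ Finset.Ioc k w.length,
        H (w.take k) ((w.take l).drop k) (w.drop l) =
      splitSum (fun a v => splitSum (fun b c => H' a b c) v) w := by
  have hsub : Finset.Icc 1 w.length ⊆ Finset.range (w.length + 1) := by
    intro k hk
    rw [Finset.mem_Icc] at hk
    rw [Finset.mem_range]
    omega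
  rw [splitSum_splitSum, ← Finset.sum_subset hsub]
  · refine Finset.sum_congr rfl fun k hk => ?_
    rw [Finset.mem_Icc] at hk
    have hsub' : Finset.Ioc k w.length ⊆ Finset.Icc k w.length := Finset.Ioc_subset_Icc_self
    rw [← Finset.sum_subset hsub']
    · refine Finset.sum_congr rfl fun l hl => h _ _ _ ?_ ?_
      · rw [← List.length_pos_iff, List.length_take]
        omega
      · rw [Finset.mem_Ioc] at hl
        simp only [ne_eq, List.drop_eq_nil_iff, List.length_take]
        omega
    · intro l hl hl'
      rw [Finset.mem_Icc] at hl
      rw [Finset.mem_Ioc] at hl'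
      rw [show l = k by omega, List.drop_take, Nat.sub_self, List.take_zero, hb]
  · intro k hk hk'
    rw [Finset.mem_range] at hk
    rw [Finset.mem_Icc] at hk'
    refine Finset.sum_eq_zero fun l _ => ?_
    rw [show k = 0 by omega, List.take_zero, ha]

theorem flexRight_concat {K : Type} [Field K] (a b c : List K) (x : K) :
    flexRight (a ++ [x]) b c = a ++ (x + b.sum) :: c := by
  rw [flexRight, List.reverse_append]
  simp

theorem arit_apply (A B : ARI) (r : ℕ) :
    arit A B r = aritWord (atWord (A : Mould)) (atWord (B : Mould)) (genericWord r) := by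
  have h₁ := sum_range_Ioo_eq_splitSum
    (fun a b c => atWord (B : Mould) (flexLeft a b c) * atWord (A : Mould) b)
    (fun a b c => atWord (A : Mould) b *
      onHead c fun x c' => atWord (B : Mould) (a ++ (b.sum + x) :: c')) (genericWord r)
    (fun a b c _ hc => by
      cases c with
      | nil => exact absurd rfl hc
      | cons x c => exact mul_comm _ _)
    (fun a c => by rw [atWord_nil, zero_mul]) (fun a b => mul_zero _)
  have h₂ := sum_Icc_Ioc_eq_splitSum
    (fun a b c => atWord (B : Mould) (flexRight a b c) * atWord (A : Mould) b)
    (fun a b c => atWord (A : Mould) b *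
      onLast a fun a' x => atWord (B : Mould) (a' ++ (x + b.sum) :: c)) (genericWord r)
    (fun a b c ha _ => by
      rcases List.eq_nil_or_concat a with rfl | ⟨a, x, rfl⟩
      · exact absurd rfl ha
      · simp only [List.concat_eq_append, onLast_concat, flexRight_concat]
        exact mul_comm _ _)
    (fun b c => mul_zero _) (fun a c => by rw [atWord_nil, zero_mul])
  rw [length_genericWord] at h₁ h₂
  rw [arit, h₁, h₂, aritWord]
  simp only [mul_sub, splitSum_sub]

theorem mu_apply (A B : Mould) (r : ℕ) :
    mu A B r = splitSum (fun a b => atWord A a * atWord B b) (genericWord r) := by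
  rw [mu, splitSum, length_genericWord]

section Associative

attribute [local instance] LieRing.ofAssociativeRing

/-! ### Injectivity -/

theorem coeff_evWord_ofFn {r : ℕ} (y z : Fin r → ℕ) :
    MvPolynomial.coeff (Finsupp.equivFunOnFinite.symm z) (evWord (List.ofFn y) (polyWord r)) =
      if List.ofFn y = List.ofFn z then (-1 : ℚ) ^ (∑ j, y j) else 0 := by
  have h : (∏ j, MvPolynomial.X j ^ y j : MvPolynomial (Fin r) ℚ) =
      MvPolynomial.monomial (Finsupp.equivFunOnFinite.symm y) 1 := by
    rw [MvPolynomial.monomial_eq, map_one, one_mul, Finsupp.prod_fintype _ _ fun _ => pow_zero _]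
    rfl
  have hc : ((-1) ^ (∑ j, y j) : MvPolynomial (Fin r) ℚ) =
      MvPolynomial.C ((-1) ^ (∑ j, y j)) := by
    rw [map_pow, map_neg, map_one]
  rw [polyWord, evWord_ofFn, h, hc, MvPolynomial.coeff_C_mul, MvPolynomial.coeff_monomial]
  simp only [EmbeddingLike.apply_eq_iff_eq, List.ofFn_inj, mul_ite, mul_one, mul_zero]

theorem coeff_ev_polyWord (f : PolyC) {r : ℕ} (z : Fin r → ℕ) :
    MvPolynomial.coeff (Finsupp.equivFunOnFinite.symm z) (ev f (polyWord r)) =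
      (-1) ^ (∑ j, z j) * f.coeff (FreeMonoid.ofList (List.ofFn z)) := by
  classical
  have h : (MvPolynomial.lcoeff ℚ (Finsupp.equivFunOnFinite.symm z)).comp
      ((LinearMap.proj (polyWord r)).comp ev) = ((-1 : ℚ) ^ (∑ j, z j)) •
        (Finsupp.lapply (FreeMonoid.ofList (List.ofFn z))).comp
          (MonoidAlgebra.coeffLinearEquiv ℚ : PolyC ≃ₗ[ℚ] (FreeMonoid ℕ →₀ ℚ)).toLinearMap := by
    apply polyC_hom_ext
    intro v
    change MvPolynomial.coeff (Finsupp.equivFunOnFinite.symm z)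
      (ev (MonoidAlgebra.single (FreeMonoid.ofList v) 1) (polyWord r)) = (-1 : ℚ) ^ (∑ j, z j) *
        (MonoidAlgebra.single (FreeMonoid.ofList v) (1 : ℚ)).coeff (FreeMonoid.ofList (List.ofFn z))
    rw [ev_single, MonoidAlgebra.coeff_single, Finsupp.single_apply]
    rcases eq_or_ne v.length r with rfl | hv
    · have h := coeff_evWord_ofFn v.get z
      rw [List.ofFn_get] at h
      rw [h]
      by_cases hvz : v = List.ofFn z
      · have hz : v.get = z := by
          apply List.ofFn_injective
          rw [List.ofFn_get]
          exact hvz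
        rw [if_pos hvz, if_pos (congrArg _ hvz), hz, mul_one]
      · rw [if_neg hvz, if_neg fun h => hvz (FreeMonoid.ofList.injective h), mul_zero]
    · rw [evWord_of_length_ne (by rwa [polyWord, List.length_ofFn]), MvPolynomial.coeff_zero,
        if_neg, mul_zero]
      intro h
      apply hv
      rw [FreeMonoid.ofList.injective h, List.length_ofFn]
  exact LinearMap.congr_fun h f

theorem eq_zero_of_ev_genericWord {f : PolyC} (h : ∀ r, ev f (genericWord r) = 0) : f = 0 := by
  apply MonoidAlgebra.coeff_injective
  refine Finsupp.ext fun m => ?_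
  have h₁ := h m.toList.length
  rw [ev_genericWord, map_eq_zero_iff _ (polyToRat_injective _)] at h₁
  have h₂ := coeff_ev_polyWord f m.toList.get
  rw [h₁, MvPolynomial.coeff_zero, List.ofFn_get] at h₂
  have h₃ := (mul_eq_zero.1 h₂.symm).resolve_left (pow_ne_zero _ (by norm_num))
  exact h₃

theorem Delta_ne_zero {r : ℕ} (hr : r ≠ 0) : Delta r ≠ 0 := by
  rw [Delta_eq]
  have h := goodWord_genericWord r
  refine mul_ne_zero h.prod_ne_zero (h _ List.infix_rfl fun h' => hr ?_)
  rw [← length_genericWord r, h', List.length_nil]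

theorem Da_apply (P : LieAB) {r : ℕ} (hr : r ≠ 0) : (Da P : Mould) r = ma P r / Delta r :=
  if_neg hr

theorem partC_eq_zero_of_Da {P : LieAB} (h : Da P = 0) : partC P = 0 := by
  apply expandC_injective
  apply eq_zero_of_ev_genericWord
  intro r
  rcases eq_or_ne r 0 with rfl | hr
  · exact ev_expandC_nil _
  · have h₁ : (Da P : Mould) r = 0 := by rw [h]; rfl
    rw [Da_apply P hr, ma_apply, div_eq_zero_iff] at h₁
    exact h₁.resolve_right (Delta_ne_zero hr)

theorem shiftC_injective {X : LieC} (h : shiftC X = 0) : X = 0 := by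
  apply expandC_injective
  apply eq_zero_of_ev_genericWord
  intro r
  rcases eq_or_ne r 0 with rfl | hr
  · exact ev_expandC_nil _
  · have h₁ := ev_shiftC X (genericWord r)
    rw [h, map_zero, map_zero, Pi.zero_apply, eq_comm, mul_eq_zero, neg_eq_zero] at h₁
    refine h₁.resolve_left (right_ne_zero_of_mul (a := (genericWord r).prod) ?_)
    rw [← Delta_eq]
    exact Delta_ne_zero hr

theorem inclC_injective {X : LieC} (h : inclC X = 0) : X = 0 := by
  rw [← partC_inclC X, h, map_zero]

/-! ### The derivations with values in `Lie[C₁, C₂, …]` -/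

/-- The Lie algebra of the derivations which kill `[a, b]` and take values in
`Lie[C₁, C₂, …]`. -/
def derC₀ : LieSubalgebra ℚ DerAB where
  carrier := {D | D ⁅genA, genB⁆ = 0 ∧ ∀ P, coeffA (D P) = 0}
  add_mem' := by
    rintro D E ⟨h₁, h₂⟩ ⟨h₃, h₄⟩
    refine ⟨?_, fun P => ?_⟩
    · rw [LieDerivation.add_apply, h₁, h₃, add_zero]
    · rw [LieDerivation.add_apply, map_add, h₂, h₄, add_zero]
  zero_mem' := ⟨rfl, fun P => by rw [LieDerivation.zero_apply, map_zero]⟩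
  smul_mem' := by
    rintro c D ⟨h₁, h₂⟩
    refine ⟨?_, fun P => ?_⟩
    · rw [LieDerivation.smul_apply, h₁, smul_zero]
    · rw [LieDerivation.smul_apply, map_smul, h₂, smul_zero]
  lie_mem' := by
    rintro D E ⟨h₁, h₂⟩ ⟨h₃, h₄⟩
    refine ⟨?_, fun P => ?_⟩
    · rw [LieDerivation.lie_apply, h₁, h₃, map_zero, map_zero, sub_zero]
    · rw [LieDerivation.lie_apply, map_sub, h₂, h₄, sub_zero]

theorem mem_derC₀ {D : DerAB} : D ∈ derC₀ ↔ D ⁅genA, genB⁆ = 0 ∧ ∀ P, coeffA (D P) = 0 := Iff.rfl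

theorem derC₀_le {D : DerAB} (h : D ∈ derC₀) : D ∈ derZero := ⟨h.1, h.2 genA⟩

theorem apply_eq_inclC {D : DerAB} (h : D ∈ derC₀) (P : LieAB) : D P = inclC (partC (D P)) := by
  have h₁ := eq_smul_add_inclC (D P)
  rwa [(mem_derC₀.1 h).2 P, zero_smul, zero_add] at h₁

theorem lie_add_shiftC_eq_zero {D : DerAB} (h : D ∈ derC₀) :
    ⁅partC (D genA), FreeLieAlgebra.of ℚ 0⁆ + shiftC (partC (D genB)) = 0 := by
  apply inclC_injective
  rw [map_add, LieHom.map_lie, ← genA_lie_inclC, ← apply_eq_inclC h, ← apply_eq_inclC h, inclC_of,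
    adA_zero, add_comm, ← lieDerivation_lie]
  exact h.1

theorem ev_apply_apply {D E : DerAB} (hD : D ∈ derC₀) (hE : E ∈ derC₀) {K : Type} [Field K]
    [Algebra ℚ K] {w : List K} (hw : GoodWord w) :
    ev (expandC (partC (D (E genA)))) w =
      derMould (ev (expandC (partC (D genA)))) (ev (expandC (partC (E genA)))) w := by
  rw [apply_eq_inclC hE genA, der_inclC D _ _ (apply_eq_inclC hD genA) (apply_eq_inclC hD genB),
    partC_inclC, partC_inclC, expandC_freeDerivation]
  exact ev_polyDer _ _ (fun n b hb => ev_derC (lie_add_shiftC_eq_zero hD) n hb) _ hw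

/-- `Ψ` is compatible with the brackets on derivations with values in `Lie[C₁, C₂, …]`. -/
theorem Da_lie {D E : DerAB} (hD : D ∈ derC₀) (hE : E ∈ derC₀) :
    Da (⁅D, E⁆ genA) = ⁅Da (D genA), Da (E genA)⁆ := by
  apply Subtype.ext
  funext r
  change _ = ari (Da (D genA)) (Da (E genA)) r
  rcases eq_or_ne r 0 with rfl | hr
  · exact (show ari (Da (D genA)) (Da (E genA)) 0 = 0 from ari_mem _ _).symm
  · have hw := goodWord_genericWord r
    rw [Da_apply _ hr, div_eq_iff (Delta_ne_zero hr), ma_apply, LieDerivation.lie_apply, map_sub,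
      map_sub, map_sub, Pi.sub_apply, ev_apply_apply hD hE hw, ev_apply_apply hE hD hw,
      derMould_sub_derMould (isDeltaMul_Da _) (isDeltaMul_Da _) hw, ← Delta_eq, mul_comm]
    congr 1
    change _ = arit (Da (E genA)) (Da (D genA)) r - arit (Da (D genA)) (Da (E genA)) r +
      (mu (Da (D genA)) (Da (E genA)) r - mu (Da (E genA)) (Da (D genA)) r)
    rw [arit_apply, arit_apply, mu_apply, mu_apply]

theorem eq_zero_of_Da {D : DerAB} (hD : D ∈ derC₀) (h : Da (D genA) = 0) : D = 0 := by
  have hA : partC (D genA) = 0 := partC_eq_zero_of_Da h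
  have hB : partC (D genB) = 0 := by
    have h₁ := lie_add_shiftC_eq_zero hD
    rw [hA, zero_lie, zero_add] at h₁
    exact shiftC_injective h₁
  refine LieDerivation.ext fun P => ?_
  refine freeLie_derivation_ext LieHom.id D.toLinearMap 0 (fun P Q => lieDerivation_lie D P Q)
    (fun P Q => ?_) (fun x => ?_) P
  · simp
  · cases x with
    | a =>
      change D genA = 0
      rw [apply_eq_inclC hD, hA, map_zero]
    | b =>
      change D genB = 0
      rw [apply_eq_inclC hD, hB, map_zero]

/-! ### The generators of Pollack's Lie algebra -/

theorem coeffA_adA_genB (n : ℕ) : coeffA (adA n genB) = 0 := by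
  rw [← inclC_of, coeffA_inclC]

theorem eps_genA (i : ℕ) : eps i genA = adA (2 * i) genB := freeDerivation_of _ _

theorem eps_genB (i : ℕ) : eps i genB =
    ∑ j ∈ Finset.range i, (-1 : ℚ) ^ j • ⁅adA j genB, adA (2 * i - 1 - j) genB⁆ :=
  freeDerivation_of _ _

theorem genA_lie_sum (i m : ℕ) (hm : m ≤ i) :
    ⁅genA, ∑ j ∈ Finset.range m, (-1 : ℚ) ^ j • ⁅adA j genB, adA (2 * i - 1 - j) genB⁆⁆ =
      ⁅genB, adA (2 * i) genB⁆ - (-1 : ℚ) ^ m • ⁅adA m genB, adA (2 * i - m) genB⁆ := by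
  induction m with
  | zero => rw [Finset.sum_range_zero, lie_zero, pow_zero, one_smul, adA_zero, Nat.sub_zero, sub_self]
  | succ m ih =>
    rw [Finset.sum_range_succ, lie_add, ih (by omega), lie_smul, leibniz_lie, ← adA_succ,
      ← adA_succ, show 2 * i - 1 - m + 1 = 2 * i - m by omega,
      show 2 * i - 1 - m = 2 * i - (m + 1) by omega, pow_succ, smul_add, mul_neg_one, neg_smul]
    abel

theorem eps_mem_derC₀ (i : ℕ) : eps i ∈ derC₀ := by
  refine ⟨?_, fun P => ?_⟩
  · rw [lieDerivation_lie, eps_genA, eps_genB, genA_lie_sum i i le_rfl,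
      show 2 * i - i = i by omega, lie_self, smul_zero, sub_zero, ← lie_skew, neg_add_cancel]
  · induction P using freeLie_induction with
    | of x =>
      cases x with
      | a =>
        change coeffA (eps i genA) = 0
        rw [eps_genA, coeffA_adA_genB]
      | b =>
        change coeffA (eps i genB) = 0
        rw [eps_genB, map_sum]
        exact Finset.sum_eq_zero fun j _ => by rw [map_smul, coeffA_lie, smul_zero]
    | zero => rw [map_zero, map_zero]
    | add P Q h₁ h₂ => rw [map_add, map_add, h₁, h₂, add_zero]
    | smul c P h => rw [map_smul, map_smul, h, smul_zero]
    | lie P Q _ _ => rw [lieDerivation_lie, map_add, coeffA_lie, coeffA_lie, add_zero]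

theorem Da_eps (i : ℕ) : Da (eps i genA) = mouldU (2 * (i : ℤ) - 2) := by
  apply Subtype.ext
  funext r
  change _ = (Pi.single 1 (var 0 ^ (2 * (i : ℤ) - 2)) : Mould) r
  rcases eq_or_ne r 0 with rfl | hr
  · rfl
  · have hev : ma (eps i genA) r = ev (letterC (2 * i)) (genericWord r) := by
      rw [ma_apply, eps_genA, ← inclC_of, partC_inclC, expandC_of]
    rw [Da_apply _ hr, hev]
    rcases eq_or_ne r 1 with rfl | hr1
    · have hword : genericWord 1 = [var 0] := by
        rw [genericWord, List.ofFn_succ, List.ofFn_zero]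
      have hu : (var 0 : RatFun 1) ≠ 0 :=
        (goodWord_genericWord 1).mem_ne_zero (by rw [hword]; exact List.mem_singleton_self _)
      rw [Pi.single_eq_same, Delta_eq, hword, ev_letterC, onHead_cons, if_pos rfl,
        List.prod_singleton, List.sum_singleton, Even.neg_pow (even_two_mul i), zpow_sub₀ hu, ← pow_two]
      norm_cast
    · rw [Pi.single_eq_of_ne hr1, ev_letterC]
      have hlen := length_genericWord r
      generalize genericWord r = w at *
      match w, hlen with
      | [], _ => exact zero_div _
      | [x], h => exact absurd h.symm hr1
      | x :: y :: w, _ => rw [onHead_cons, if_neg (List.cons_ne_nil y w), zero_div]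

theorem pollack_le : pollack ≤ derC₀ := by
  rw [pollack, LieSubalgebra.lieSpan_le]
  rintro _ ⟨i, rfl⟩
  exact eps_mem_derC₀ i

theorem mouldU_mem_algU {n : ℤ} (hn : -1 ≤ n) : mouldU (2 * n) ∈ algU := by
  rw [algU, Submodule.mem_sInf]
  exact fun V hV => hV.1 n hn

theorem mouldU_two_mul_sub_mem (i : ℕ) : mouldU (2 * (i : ℤ) - 2) ∈ algU := by
  rw [show 2 * (i : ℤ) - 2 = 2 * ((i : ℤ) - 1) by ring]
  exact mouldU_mem_algU (by omega)

theorem Da_mem_algU {D : DerAB} (hD : D ∈ pollack) : Da (D genA) ∈ algU := by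
  rw [pollack] at hD
  induction hD using LieSubalgebra.lieSpan_induction with
  | mem D h =>
    obtain ⟨i, rfl⟩ := h
    rw [Da_eps]
    exact mouldU_two_mul_sub_mem i
  | zero =>
    rw [LieDerivation.zero_apply, map_zero]
    exact zero_mem _
  | add D E _ _ h₁ h₂ =>
    rw [LieDerivation.add_apply, map_add]
    exact add_mem h₁ h₂
  | smul c D _ h =>
    rw [LieDerivation.smul_apply, map_smul]
    exact Submodule.smul_mem _ c h
  | lie D E hD hE h₁ h₂ =>
    rw [Da_lie (pollack_le hD) (pollack_le hE)]
    exact algU_lie_mem h₁ h₂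

/-- The restriction of `Ψ` to Pollack's Lie algebra. -/
def pollackMap : pollack →ₗ[ℚ] algU where
  toFun D := ⟨Da ((D : DerAB) genA), Da_mem_algU D.2⟩
  map_add' D E := Subtype.ext (by
    change Da (((D : DerAB) + (E : DerAB)) genA) = Da ((D : DerAB) genA) + Da ((E : DerAB) genA)
    rw [LieDerivation.add_apply, map_add])
  map_smul' c D := Subtype.ext (by
    change Da ((c • (D : DerAB)) genA) = c • Da ((D : DerAB) genA)
    rw [LieDerivation.smul_apply, map_smul])

theorem pollackMap_lie (D E : pollack) : pollackMap ⁅D, E⁆ = ⁅pollackMap D, pollackMap E⁆ :=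
  Subtype.ext (Da_lie (pollack_le D.2) (pollack_le E.2))

theorem pollackMap_bijective : Function.Bijective pollackMap := by
  constructor
  · refine (injective_iff_map_eq_zero pollackMap).2 fun D h => ?_
    apply Subtype.ext
    exact eq_zero_of_Da (pollack_le D.2) (congrArg Subtype.val h)
  · rintro ⟨A, hA⟩
    have h : A ∈ (LinearMap.range pollackMap).map algU.subtype := by
      rw [algU, Submodule.mem_sInf] at hA
      apply hA
      constructor
      · intro i hi
        obtain ⟨n, hn⟩ := Int.eq_ofNat_of_zero_le (show 0 ≤ i + 1 by omega)
        refine ⟨_, ⟨⟨eps n, LieSubalgebra.subset_lieSpan ⟨n, rfl⟩⟩, rfl⟩, ?_⟩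
        change Da (eps n genA) = _
        rw [Da_eps]
        congr 1
        omega
      · rintro _ ⟨_, ⟨D, rfl⟩, rfl⟩ _ ⟨_, ⟨E, rfl⟩, rfl⟩
        exact ⟨_, ⟨⁅D, E⁆, rfl⟩, congrArg Subtype.val (pollackMap_lie D E)⟩
    obtain ⟨_, ⟨D, rfl⟩, hD⟩ := h
    exact ⟨D, Subtype.ext hD⟩

/-- The isomorphism between Pollack's Lie algebra and `𝒰`. -/
def pollackEquiv : pollack ≃ₗ[ℚ] algU := LinearEquiv.ofBijective pollackMap pollackMap_bijective

theorem pollackEquiv_lie (D E : pollack) :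
    pollackEquiv ⁅D, E⁆ = ⁅pollackEquiv D, pollackEquiv E⁆ := pollackMap_lie D E

theorem isLieAlgebra_algU : IsLieAlgebra algU := by
  have h : ∀ x : algU, ∃ D, pollackEquiv D = x := pollackEquiv.surjective
  constructor
  · intro x y z
    obtain ⟨D, rfl⟩ := h x
    obtain ⟨E, rfl⟩ := h y
    obtain ⟨F, rfl⟩ := h z
    rw [← map_add]
    simp only [← pollackEquiv_lie]
    rw [add_lie, map_add]
  · intro x y z
    obtain ⟨D, rfl⟩ := h x
    obtain ⟨E, rfl⟩ := h y
    obtain ⟨F, rfl⟩ := h z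
    rw [← map_add]
    simp only [← pollackEquiv_lie]
    rw [lie_add, map_add]
  · intro c x y
    obtain ⟨D, rfl⟩ := h x
    obtain ⟨E, rfl⟩ := h y
    rw [← map_smul]
    simp only [← pollackEquiv_lie]
    rw [smul_lie, map_smul]
  · intro c x y
    obtain ⟨D, rfl⟩ := h x
    obtain ⟨E, rfl⟩ := h y
    rw [← map_smul]
    simp only [← pollackEquiv_lie]
    rw [lie_smul, map_smul]
  · intro x
    obtain ⟨D, rfl⟩ := h x
    rw [← pollackEquiv_lie, lie_self, map_zero]
  · intro x y z
    obtain ⟨D, rfl⟩ := h x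
    obtain ⟨E, rfl⟩ := h y
    obtain ⟨F, rfl⟩ := h z
    simp only [← pollackEquiv_lie]
    rw [← map_add, leibniz_lie]

end Associative

end EllipticMould
end

theorem mainTheorem4 :
    (∀ i : ℕ, ∃ h : EllipticMould.eps i ∈ EllipticMould.derZero,
      EllipticMould.Psi ⟨EllipticMould.eps i, h⟩ = EllipticMould.mouldU (2 * (i : ℤ) - 2) ∧
        EllipticMould.mouldU (2 * (i : ℤ) - 2) ∈ EllipticMould.algU) ∧
    ∃ hE : ∀ D ∈ EllipticMould.pollack, D ∈ EllipticMould.derZero,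
      EllipticMould.IsLieAlgebra EllipticMould.algU ∧
      ∃ e : EllipticMould.pollack ≃ₗ[ℚ] EllipticMould.algU,
        (∀ D : EllipticMould.pollack,
          ((e D : EllipticMould.algU) : EllipticMould.ARI) =
            EllipticMould.Psi ⟨(D : EllipticMould.DerAB), hE D D.2⟩) ∧
        ∀ D₁ D₂ : EllipticMould.pollack, e ⁅D₁, D₂⁆ = ⁅e D₁, e D₂⁆ :=
  ⟨fun i => ⟨EllipticMould.derC₀_le (EllipticMould.eps_mem_derC₀ i), EllipticMould.Da_eps i,
      EllipticMould.mouldU_two_mul_sub_mem i⟩,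
    fun _ hD => EllipticMould.derC₀_le (EllipticMould.pollack_le hD),
    EllipticMould.isLieAlgebra_algU, EllipticMould.pollackEquiv, fun _ => rfl,
    EllipticMould.pollackEquiv_lie⟩
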